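/- Let $\varphi=\frac{1+\sqrt5}{2}$ and let $v_1=(\varphi,1,0)$, $v_2=(\varphi,-1,0)$, $v_3=(0,\varphi,1)$, $v_4=(0,\varphi,-1)$, $v_5=(1,0,\varphi)$, $v_6=(-1,0,\varphi)$, so that $\pm v_1,\dots,\pm v_6$ are the vertices of a regular icosahedron. For $1\le i<j<k\le 6$ let $T_{ijk}=\{\lambda v_i+\mu v_j+\nu v_k : 0\le\lambda,\mu,\nu\le 1\}$; these are the $20$ *golden rhombohedra*. Up to isometry they are of two types: the *thin* ones $T_{123},T_{124},T_{136},T_{145},T_{156},T_{235},T_{246},T_{256},T_{345},T_{346}$, and the ten other ones, called *fat*, whose volume is $\varphi$ times larger. A *golden tiling* is a covering of $\mathbb R^3$ by translates of golden rhombohedra (tiles) such that any two distinct tiles are either disjoint or intersect exactly in a common whole face, a common whole edge or a common vertex. For $i\ne j$, an *$ij$-worm* of a golden tiling is a biinfinite sequence $(\tau_n)_{n\in\mathbb Z}$ of its tiles such that, for every $n$, $\tau_n$ and $\tau_{n+1}$ are adjacent along a face generated by $v_i$ and $v_j$, and $\tau_n\neq\tau_{n+2}$ (the sequence does not turn back).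 The tiles of an $ij$-worm are translates of rhombohedra $T_{ijk}$ (with unordered indices), $k\notin\{i,j\}$; two of the four values of $k$ give the thin type and two the fat type, so that each type can occur in two orientations. The tiling has *alternation* if, in every $ij$-worm, for all $i\neq j$ and for each of the two types, the two orientations strictly alternate along the worm: if $m<n$, $\tau_m$ and $\tau_n$ have the same type and no $\tau_l$ with $m<l<n$ has that type, then $\tau_m$ and $\tau_n$ are not translates of each other. Let $e_1,\dots,e_6$ be the canonical basis of $\mathbb R^6$. A *lift* of a golden tiling is a map $L$ from its vertices to $\mathbb Z^6$ which maps some vertex to $0$ and satisfies $L(x+\sum_{a\in U}v_a)=L(x)+\sum_{a\in U}e_a$ for every tile $x+T_{ijk}$ and every $U\subseteq\{i,j,k\}$; the lifted tiling is then the union, over all tiles $x+T_{ijk}$, of the three-dimensional faces $\{L(x)+\lambda e_i+\mu e_j+\nu e_k:0\le\lambda,\mu,\nu\le1\}$ of unit hypercubes. A golden tiling is *planar* if there are a real $t\ge 1$, a $3$-dimensional vector subspace $E$ of $\mathbb R^6$ and a lift for which the lifted tiling is contained in the tube $E+[0,t]^6$. **Theorem.** Every golden tiling with alternation is planar. -/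

import Mathlib

open scoped Pointwise

namespace Golden

/-- The vectors `v₁, …, v₆` (indexed here by `0, …, 5`): one out of each pair of opposite vertices
of a regular icosahedron. -/
noncomputable def v : Fin 6 → (Fin 3 → ℝ) :=
  ![![Real.goldenRatio, 1, 0], ![Real.goldenRatio, -1, 0],
    ![0, Real.goldenRatio, 1], ![0, Real.goldenRatio, -1],
    ![1, 0, Real.goldenRatio], ![-1, 0, Real.goldenRatio]]

/-- The canonical basis of `ℝ⁶`. -/
def e (i : Fin 6) : Fin 6 → ℝ := Pi.single i 1

/-- The parallelotope with base point `p` spanned by the generators `g i`, `i ∈ D`. -/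
def cell {M : Type*} [AddCommGroup M] [Module ℝ M] (g : Fin 6 → M) (p : M) (D : Finset (Fin 6)) :
    Set M :=
  {x | ∃ c : Fin 6 → ℝ, (∀ i, 0 ≤ c i ∧ c i ≤ 1) ∧ x = p + ∑ i ∈ D, c i • g i}

/-- A translated copy of a golden rhombohedron `T_ijk`: `dirs = {i, j, k}`, and `pos` is the
translation vector. -/
structure Tile where
  dirs : Finset (Fin 6)
  card_dirs : dirs.card = 3
  pos : Fin 3 → ℝ

/-- The rhombohedron itself, as a subset of `ℝ³`. -/
def Tile.carrier (τ : Tile) : Set (Fin 3 → ℝ) := cell v τ.pos τ.dirs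

/-- The vertex of the tile `τ` that corresponds to the set of directions `U ⊆ τ.dirs`. -/
noncomputable def Tile.corner (τ : Tile) (U : Finset (Fin 6)) : Fin 3 → ℝ :=
  τ.pos + ∑ i ∈ U, v i

/-- `F` is a face of the tile `τ`, generated by the vectors `v i`, `i ∈ D`. For `D` of cardinality
`0`, `1`, `2` this is a vertex, an edge, a two-dimensional face of `τ`. -/
def Tile.IsFace (τ : Tile) (D : Finset (Fin 6)) (F : Set (Fin 3 → ℝ)) : Prop :=
  D ⊆ τ.dirs ∧ ∃ U ⊆ τ.dirs \ D, F = cell v (τ.corner U) D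

/-- A golden tiling: a covering of `ℝ³` by translated copies of the golden rhombohedra, two
distinct ones being either disjoint or meeting exactly in a common whole face, a common whole edge
or a common vertex. -/
structure Tiling where
  tiles : Set Tile
  covers : ⋃ τ ∈ tiles, τ.carrier = Set.univ
  face_to_face : ∀ σ ∈ tiles, ∀ τ ∈ tiles, σ ≠ τ → (σ.carrier ∩ τ.carrier).Nonempty →
    ∃ D : Finset (Fin 6), D.card ≤ 2 ∧
      σ.IsFace D (σ.carrier ∩ τ.carrier) ∧ τ.IsFace D (σ.carrier ∩ τ.carrier)

/-- The vertices of a tiling. -/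
def Tiling.vertices (T : Tiling) : Set (Fin 3 → ℝ) :=
  {x | ∃ τ ∈ T.tiles, ∃ U ⊆ τ.dirs, x = τ.corner U}

/-- The index sets of the thin rhombohedra `T₁₂₃, T₁₂₄, T₁₃₆, T₁₄₅, T₁₅₆, T₂₃₅, T₂₄₆, T₂₅₆, T₃₄₅,
T₃₄₆` (with indices shifted by one). They are isometric to each other. The ten other rhombohedra,
the fat ones, are also isometric to each other, and have `φ` times the volume of the thin ones. -/
def thinTriples : Finset (Finset (Fin 6)) :=
  {{0, 1, 2}, {0, 1, 3}, {0, 2, 5}, {0, 3, 4}, {0, 4, 5},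
   {1, 2, 4}, {1, 3, 5}, {1, 4, 5}, {2, 3, 4}, {2, 3, 5}}

/-- The tile is of the thin type; otherwise it is of the fat type. -/
def Tile.IsThin (τ : Tile) : Prop := τ.dirs ∈ thinTriples

/-- Two tiles are of the same type (both thin or both fat). -/
def Tile.SameType (σ τ : Tile) : Prop := σ.IsThin ↔ τ.IsThin

/-- An `ij`-worm of the tiling `T`: a biinfinite sequence of tiles of `T`, each one being adjacent
to the following one along a face generated by `v i` and `v j`. The last condition says that the
sequence never turns back, that is, that it leaves each tile through the face opposite to the one
through which it entered. -/
structure Tiling.IsWorm (T : Tiling) (i j : Fin 6) (s : ℤ → Tile) : Prop where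
  mem : ∀ n, s n ∈ T.tiles
  adjacent : ∀ n, (s n).IsFace {i, j} ((s n).carrier ∩ (s (n + 1)).carrier) ∧
    (s (n + 1)).IsFace {i, j} ((s n).carrier ∩ (s (n + 1)).carrier)
  no_return : ∀ n, s n ≠ s (n + 2)

/-- Alternation: in every worm, any two successive tiles of the same type (two tiles of that type
with no tile of that type between them) have different orientations. In an `ij`-worm each type has
only two orientations, `T_ijk` and `T_ijl` for two indices `k ≠ l`, so that these alternate. -/
def Tiling.HasAlternation (T : Tiling) : Prop :=
  ∀ i j : Fin 6, i ≠ j → ∀ s : ℤ → Tile, T.IsWorm i j s →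
    ∀ m n : ℤ, m < n → (s m).SameType (s n) →
      (∀ l, m < l → l < n → ¬ (s l).SameType (s m)) →
      (s m).dirs ≠ (s n).dirs

/-- `L` lifts the tiling `T` to `ℝ⁶`: it maps the vertices of `T` to `ℤ⁶`, some vertex to the
origin, and the vertices of each tile `T_ijk` to those of a three-dimensional face of a unit
hypercube, generated by `e i`, `e j`, `e k`, each edge `v i` of the tile going to the edge `e i`.
Tiles which share a face are thus mapped to faces of hypercubes which share the corresponding
face. The values of `L` outside of the vertices of `T` are irrelevant. -/
def Tiling.IsLift (T : Tiling) (L : (Fin 3 → ℝ) → (Fin 6 → ℤ)) : Prop :=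
  (∃ x ∈ T.vertices, L x = 0) ∧
    ∀ τ ∈ T.tiles, ∀ U ⊆ τ.dirs, L (τ.corner U) = L τ.pos + ∑ i ∈ U, Pi.single i 1

/-- The stepped manifold in `ℝ⁶` defined by a lift `L` of `T`: the union of the three-dimensional
faces of unit hypercubes to which the tiles are mapped. -/
def Tiling.lifted (T : Tiling) (L : (Fin 3 → ℝ) → (Fin 6 → ℤ)) : Set (Fin 6 → ℝ) :=
  ⋃ τ ∈ T.tiles, cell e (fun k => (L τ.pos k : ℝ)) τ.dirs

/-- A tiling is planar if it can be lifted in a tube `E + [0, t]⁶` with `t ≥ 1` and `E` a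
three-dimensional vector subspace of `ℝ⁶`. -/
def Tiling.IsPlanar (T : Tiling) : Prop :=
  ∃ t : ℝ, 1 ≤ t ∧ ∃ E : Submodule ℝ (Fin 6 → ℝ), Module.finrank ℝ E = 3 ∧
    ∃ L : (Fin 3 → ℝ) → (Fin 6 → ℤ), T.IsLift L ∧
      T.lifted L ⊆ (E : Set (Fin 6 → ℝ)) + Set.Icc (0 : Fin 6 → ℝ) (fun _ => t)

end Golden

open scoped Matrix

namespace Golden

/-- The normal vector `v i × v j`, which spans a two-fold axis when `i ≠ j`. -/
noncomputable def normal (i j : Fin 6) : Fin 3 → ℝ := v i ⨯₃ v j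

/-- For a pair `i, j`, the two thin directions `k, l` and the two fat directions `m, n`, together
with the signs of their scalar products with the normal vector. -/
structure PairFrame (i j k l m n : Fin 6) (a b c d : ℝ) : Prop where
  nodup : [i, j, k, l, m, n].Nodup
  thin_k : ({i, j, k} : Finset (Fin 6)) ∈ thinTriples
  thin_l : ({i, j, l} : Finset (Fin 6)) ∈ thinTriples
  fat_m : ({i, j, m} : Finset (Fin 6)) ∉ thinTriples
  fat_n : ({i, j, n} : Finset (Fin 6)) ∉ thinTriples
  sign_a : a = 1 ∨ a = -1
  sign_b : b = 1 ∨ b = -1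
  sign_c : c = 1 ∨ c = -1
  sign_d : d = 1 ∨ d = -1
  dot_k : normal i j ⬝ᵥ v k = 2 * Real.goldenRatio * a
  dot_l : normal i j ⬝ᵥ v l = 2 * Real.goldenRatio * b
  dot_m : normal i j ⬝ᵥ v m = 2 * Real.goldenRatio ^ 2 * c
  dot_n : normal i j ⬝ᵥ v n = 2 * Real.goldenRatio ^ 2 * d
  thin_sum : a • v k + b • v l = (Real.goldenRatio - 1) • normal i j
  fat_sum : c • v m + d • v n = normal i j
  norm_sq : normal i j ⬝ᵥ normal i j = 4 * Real.goldenRatio ^ 2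

lemma normal_swap (i j : Fin 6) : normal j i = -normal i j := by
  simp only [normal]; rw [← cross_anticomm]

lemma PairFrame.swap {i j k l m n : Fin 6} {a b c d : ℝ} (h : PairFrame i j k l m n a b c d) :
    PairFrame j i k l m n (-a) (-b) (-c) (-d) where
  nodup := (List.Perm.swap i j _).nodup_iff.2 h.nodup
  thin_k := by rw [Finset.insert_comm]; exact h.thin_k
  thin_l := by rw [Finset.insert_comm]; exact h.thin_l
  fat_m := by rw [Finset.insert_comm]; exact h.fat_m
  fat_n := by rw [Finset.insert_comm]; exact h.fat_n
  sign_a := by rcases h.sign_a with h | h <;> simp [h]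
  sign_b := by rcases h.sign_b with h | h <;> simp [h]
  sign_c := by rcases h.sign_c with h | h <;> simp [h]
  sign_d := by rcases h.sign_d with h | h <;> simp [h]
  dot_k := by rw [normal_swap, neg_dotProduct, h.dot_k]; ring
  dot_l := by rw [normal_swap, neg_dotProduct, h.dot_l]; ring
  dot_m := by rw [normal_swap, neg_dotProduct, h.dot_m]; ring
  dot_n := by rw [normal_swap, neg_dotProduct, h.dot_n]; ring
  thin_sum := by rw [normal_swap, smul_neg, ← h.thin_sum]; module
  fat_sum := by rw [normal_swap, ← h.fat_sum]; module
  norm_sq := by rw [normal_swap, neg_dotProduct, dotProduct_neg, neg_neg, h.norm_sq]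

set_option maxHeartbeats 4000000 in
lemma exists_pairFrame_of_lt {i j : Fin 6} (hij : i < j) :
    ∃ k l m n a b c d, PairFrame i j k l m n a b c d := by
  obtain ⟨φ, hφ⟩ : ∃ φ, φ = Real.goldenRatio := ⟨_, rfl⟩
  have h2 : φ ^ 2 = φ + 1 := hφ ▸ Real.goldenRatio_sq
  have h3 : φ ^ 3 = 2 * φ + 1 := by linear_combination (φ + 1) * h2
  have h4 : φ ^ 4 = 3 * φ + 2 := by linear_combination φ * h3 + 2 * h2
  have hv : v = ![![φ, 1, 0], ![φ, -1, 0], ![0, φ, 1], ![0, φ, -1], ![1, 0, φ], ![-1, 0, φ]] := by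
    rw [hφ]; rfl
  have key : i = 0 ∧ j = 1 ∨ i = 0 ∧ j = 2 ∨ i = 0 ∧ j = 3 ∨ i = 0 ∧ j = 4 ∨ i = 0 ∧ j = 5 ∨
      i = 1 ∧ j = 2 ∨ i = 1 ∧ j = 3 ∨ i = 1 ∧ j = 4 ∨ i = 1 ∧ j = 5 ∨ i = 2 ∧ j = 3 ∨
      i = 2 ∧ j = 4 ∨ i = 2 ∧ j = 5 ∨ i = 3 ∧ j = 4 ∨ i = 3 ∧ j = 5 ∨ i = 4 ∧ j = 5 := by
    revert i j; decide
  rcases key with ⟨rfl, rfl⟩ | ⟨rfl, rfl⟩ | ⟨rfl, rfl⟩ | ⟨rfl, rfl⟩ | ⟨rfl, rfl⟩ | ⟨rfl, rfl⟩ |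
    ⟨rfl, rfl⟩ | ⟨rfl, rfl⟩ | ⟨rfl, rfl⟩ | ⟨rfl, rfl⟩ | ⟨rfl, rfl⟩ | ⟨rfl, rfl⟩ | ⟨rfl, rfl⟩ |
    ⟨rfl, rfl⟩ | ⟨rfl, rfl⟩
  on_goal 1 => refine ⟨2, 3, 4, 5, -1, 1, -1, -1, ?_⟩
  rotate_left
  on_goal 1 => refine ⟨1, 5, 3, 4, 1, 1, -1, 1, ?_⟩
  rotate_left
  on_goal 1 => refine ⟨1, 4, 2, 5, -1, 1, 1, 1, ?_⟩
  rotate_left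
  on_goal 1 => refine ⟨3, 5, 1, 2, -1, -1, 1, -1, ?_⟩
  rotate_left
  on_goal 1 => refine ⟨2, 4, 1, 3, -1, 1, 1, -1, ?_⟩
  rotate_left
  on_goal 1 => refine ⟨0, 4, 3, 5, -1, 1, -1, 1, ?_⟩
  rotate_left
  on_goal 1 => refine ⟨0, 5, 2, 4, 1, 1, 1, 1, ?_⟩
  rotate_left
  on_goal 1 => refine ⟨2, 5, 0, 3, -1, 1, -1, -1, ?_⟩
  rotate_left
  on_goal 1 => refine ⟨3, 4, 0, 2, -1, -1, -1, -1, ?_⟩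
  rotate_left
  on_goal 1 => refine ⟨4, 5, 0, 1, -1, 1, -1, -1, ?_⟩
  rotate_left
  on_goal 1 => refine ⟨1, 3, 0, 5, 1, 1, 1, -1, ?_⟩
  rotate_left
  on_goal 1 => refine ⟨0, 3, 1, 4, 1, -1, 1, 1, ?_⟩
  rotate_left
  on_goal 1 => refine ⟨0, 2, 1, 5, 1, -1, 1, -1, ?_⟩
  rotate_left
  on_goal 1 => refine ⟨1, 2, 0, 4, 1, 1, 1, 1, ?_⟩
  rotate_left
  on_goal 1 => refine ⟨0, 1, 2, 3, -1, 1, -1, -1, ?_⟩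
  rotate_left
  all_goals constructor
  all_goals try rw [← hφ]
  all_goals first
    | decide
    | (left; rfl)
    | (right; rfl)
    | (simp [normal, hv, crossProduct, dotProduct, Fin.sum_univ_three]; done)
    | (simp [normal, hv, crossProduct, dotProduct, Fin.sum_univ_three, -mul_eq_mul_left_iff,
        -mul_eq_mul_right_iff]; linarith)
    | (ext t; fin_cases t <;> simp [normal, hv, crossProduct] <;> linarith)

lemma exists_pairFrame {i j : Fin 6} (hij : i ≠ j) :
    ∃ k l m n a b c d, PairFrame i j k l m n a b c d := by
  rcases lt_or_gt_of_ne hij with h | h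
  · exact exists_pairFrame_of_lt h
  · obtain ⟨k, l, m, n, a, b, c, d, h⟩ := exists_pairFrame_of_lt h
    exact ⟨k, l, m, n, _, _, _, _, h.swap⟩

end Golden

namespace Golden

lemma triple_smul_eq_sum (x y z w : Fin 3 → ℝ) :
    ((x ⨯₃ y) ⬝ᵥ z) • w =
      ((y ⨯₃ z) ⬝ᵥ w) • x + ((z ⨯₃ x) ⬝ᵥ w) • y + ((x ⨯₃ y) ⬝ᵥ w) • z := by
  ext t
  fin_cases t <;> simp [crossProduct, dotProduct, Fin.sum_univ_three] <;> ring

lemma triple_smul_eq_sum_cross (x y z w : Fin 3 → ℝ) :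
    ((x ⨯₃ y) ⬝ᵥ z) • w =
      (x ⬝ᵥ w) • (y ⨯₃ z) + (y ⬝ᵥ w) • (z ⨯₃ x) + (z ⬝ᵥ w) • (x ⨯₃ y) := by
  ext t
  fin_cases t <;> simp [crossProduct, dotProduct, Fin.sum_univ_three] <;> ring

lemma triple_rotate (x y z : Fin 3 → ℝ) : (x ⨯₃ y) ⬝ᵥ z = (y ⨯₃ z) ⬝ᵥ x := by
  simp [crossProduct, dotProduct, Fin.sum_univ_three]; ring

lemma normal_dot_left (i j : Fin 6) : normal i j ⬝ᵥ v i = 0 := by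
  rw [normal, dotProduct_comm]; exact dot_self_cross _ _

lemma normal_dot_right (i j : Fin 6) : normal i j ⬝ᵥ v j = 0 := by
  rw [normal, dotProduct_comm]; exact dot_cross_self _ _

lemma PairFrame.forall_mem {i j k l m n : Fin 6} {a b c d : ℝ} (h : PairFrame i j k l m n a b c d)
    (x : Fin 6) : x = i ∨ x = j ∨ x = k ∨ x = l ∨ x = m ∨ x = n := by
  have : x ∈ ([i, j, k, l, m, n] : List (Fin 6)).toFinset := by
    have h6 : ([i, j, k, l, m, n] : List (Fin 6)).toFinset = Finset.univ := by
      apply Finset.eq_univ_of_card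
      rw [List.toFinset_card_of_nodup h.nodup]; rfl
    rw [h6]; exact Finset.mem_univ x
  simpa using this

lemma PairFrame.sum_univ {i j k l m n : Fin 6} {a b c d : ℝ} (h : PairFrame i j k l m n a b c d)
    {M : Type*} [AddCommMonoid M] (g : Fin 6 → M) :
    ∑ x, g x = g i + (g j + (g k + (g l + (g m + g n)))) := by
  have h6 : ([i, j, k, l, m, n] : List (Fin 6)).toFinset = Finset.univ := by
    apply Finset.eq_univ_of_card
    rw [List.toFinset_card_of_nodup h.nodup]; rfl
  rw [← h6, List.sum_toFinset _ h.nodup]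
  simp

lemma triple_ne_zero {i j k : Fin 6} (hij : i ≠ j) (hki : k ≠ i) (hkj : k ≠ j) :
    normal i j ⬝ᵥ v k ≠ 0 := by
  obtain ⟨k', l, m, n, a, b, c, d, h⟩ := exists_pairFrame hij
  have hφ := Real.goldenRatio_pos
  have hne : ∀ x : ℝ, x = 1 ∨ x = -1 → x ≠ 0 := by rintro x (rfl | rfl) <;> norm_num
  rcases h.forall_mem k with rfl | rfl | rfl | rfl | rfl | rfl
  · exact absurd rfl hki
  · exact absurd rfl hkj
  · rw [h.dot_k]; exact mul_ne_zero (by positivity) (hne _ h.sign_a)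
  · rw [h.dot_l]; exact mul_ne_zero (by positivity) (hne _ h.sign_b)
  · rw [h.dot_m]; exact mul_ne_zero (by positivity) (hne _ h.sign_c)
  · rw [h.dot_n]; exact mul_ne_zero (by positivity) (hne _ h.sign_d)

lemma exists_chart {D : Finset (Fin 6)} (hD : D.card = 3) :
    ∃ A : (Fin 3 → ℝ) →L[ℝ] (Fin 6 → ℝ), (∀ a ∈ D, A (v a) = Pi.single a 1) ∧
      (∀ k, k ∉ D → ∀ w, A w k = 0) ∧ ∀ w, ∑ k ∈ D, A w k • v k = w := by
  obtain ⟨i, j, k, hij, hik, hjk, rfl⟩ := Finset.card_eq_three.1 hD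
  have h0 : normal i j ⬝ᵥ v k ≠ 0 := triple_ne_zero hij hik.symm hjk.symm
  have h1 : normal j k ⬝ᵥ v i = normal i j ⬝ᵥ v k := (triple_rotate _ _ _).symm
  have h2 : normal k i ⬝ᵥ v j = normal i j ⬝ᵥ v k := triple_rotate _ _ _
  let A : (Fin 3 → ℝ) →ₗ[ℝ] (Fin 6 → ℝ) :=
    { toFun := fun w => (normal i j ⬝ᵥ v k)⁻¹ • ((normal j k ⬝ᵥ w) • Pi.single i 1 +
        (normal k i ⬝ᵥ w) • Pi.single j 1 + (normal i j ⬝ᵥ w) • Pi.single k 1)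
      map_add' := fun x y => by simp only [dotProduct_add]; module
      map_smul' := fun r x => by
        simp only [dotProduct_smul, smul_eq_mul, RingHom.id_apply]; module }
  have hA : ∀ w, A w = (normal i j ⬝ᵥ v k)⁻¹ • ((normal j k ⬝ᵥ w) • Pi.single i 1 +
        (normal k i ⬝ᵥ w) • Pi.single j 1 + (normal i j ⬝ᵥ w) • Pi.single k 1) := fun _ => rfl
  refine ⟨LinearMap.toContinuousLinearMap A, ?_, ?_, ?_⟩
  · intro a ha
    simp only [Finset.mem_insert, Finset.mem_singleton] at ha
    simp only [LinearMap.coe_toContinuousLinearMap', hA]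
    rcases ha with rfl | rfl | rfl
    · rw [h1, normal_dot_right, normal_dot_left]; simp [smul_smul, h0]
    · rw [h2, normal_dot_right, normal_dot_left]; simp [smul_smul, h0]
    · rw [normal_dot_right, normal_dot_left]; simp [smul_smul, h0]
  · intro x hx w
    simp only [Finset.mem_insert, Finset.mem_singleton, not_or] at hx
    simp [hA, hx]
  · intro w
    simp only [LinearMap.coe_toContinuousLinearMap', hA]
    rw [Finset.sum_insert (by simp [hij, hik]), Finset.sum_insert (by simp [hjk]),
      Finset.sum_singleton]
    have := triple_smul_eq_sum (v i) (v j) (v k) w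
    simp only [Pi.smul_apply, Pi.add_apply, Pi.single_apply, hij, hik, hjk, hij.symm, hik.symm,
      hjk.symm, if_true, if_false, smul_eq_mul, mul_one, mul_zero, add_zero, zero_add, mul_smul,
      ← smul_add]
    rw [inv_smul_eq_iff₀ h0]
    simpa only [normal, add_assoc] using this.symm

/-- The linear map from `ℝ³` to `ℝ⁶` that maps `v i` to `e i` for the three directions `i ∈ D`. -/
noncomputable def chart (D : Finset (Fin 6)) : (Fin 3 → ℝ) →L[ℝ] (Fin 6 → ℝ) :=
  if h : D.card = 3 then (exists_chart h).choose else 0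

lemma chart_v {D : Finset (Fin 6)} (hD : D.card = 3) {a : Fin 6} (ha : a ∈ D) :
    chart D (v a) = Pi.single a 1 := by
  rw [chart, dif_pos hD]; exact (exists_chart hD).choose_spec.1 a ha

lemma chart_of_notMem {D : Finset (Fin 6)} (hD : D.card = 3) {k : Fin 6} (hk : k ∉ D)
    (w : Fin 3 → ℝ) : chart D w k = 0 := by
  rw [chart, dif_pos hD]; exact (exists_chart hD).choose_spec.2.1 k hk w

lemma sum_chart_smul {D : Finset (Fin 6)} (hD : D.card = 3) (w : Fin 3 → ℝ) :
    ∑ k ∈ D, chart D w k • v k = w := by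
  rw [chart, dif_pos hD]; exact (exists_chart hD).choose_spec.2.2 w

lemma sum_univ_chart_smul {D : Finset (Fin 6)} (hD : D.card = 3) (w : Fin 3 → ℝ) :
    ∑ k, chart D w k • v k = w := by
  rw [← Finset.sum_subset D.subset_univ, sum_chart_smul hD]
  intro k _ hk
  rw [chart_of_notMem hD hk, zero_smul]

lemma chart_sum {D U : Finset (Fin 6)} (hD : D.card = 3) (hU : U ⊆ D) (c : Fin 6 → ℝ) :
    chart D (∑ i ∈ U, c i • v i) = ∑ i ∈ U, Pi.single i (c i) := by
  rw [map_sum]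
  refine Finset.sum_congr rfl fun i hi => ?_
  rw [map_smul, chart_v hD (hU hi), ← Pi.single_smul, smul_eq_mul, mul_one]

lemma sum_single_apply (U : Finset (Fin 6)) (c : Fin 6 → ℝ) (k : Fin 6) :
    (∑ i ∈ U, Pi.single i (c i) : Fin 6 → ℝ) k = if k ∈ U then c k else 0 := by
  simp [Finset.sum_apply, Pi.single_apply]

lemma Tile.mem_face_iff (τ : Tile) {D U : Finset (Fin 6)} (hD : D ⊆ τ.dirs)
    (hU : U ⊆ τ.dirs \ D) (y : Fin 3 → ℝ) :
    y ∈ cell v (τ.corner U) D ↔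
      (∀ k ∈ D, 0 ≤ chart τ.dirs (y - τ.pos) k ∧ chart τ.dirs (y - τ.pos) k ≤ 1) ∧
      ∀ k ∈ τ.dirs \ D, chart τ.dirs (y - τ.pos) k = if k ∈ U then 1 else 0 := by
  have hU' : U ⊆ τ.dirs := hU.trans Finset.sdiff_subset
  have hdis : Disjoint U D := Finset.disjoint_of_subset_left hU Finset.sdiff_disjoint
  constructor
  · rintro ⟨c, hc, rfl⟩
    have key : chart τ.dirs (τ.corner U + ∑ i ∈ D, c i • v i - τ.pos) =
        ∑ i ∈ U, Pi.single i 1 + ∑ i ∈ D, Pi.single i (c i) := by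
      rw [show τ.corner U + ∑ i ∈ D, c i • v i - τ.pos
        = ∑ i ∈ U, (1 : ℝ) • v i + ∑ i ∈ D, c i • v i by simp [Tile.corner]; abel, map_add,
        chart_sum τ.card_dirs hD, chart_sum τ.card_dirs hU' (fun _ => 1)]
    rw [key]
    refine ⟨fun k hk => ?_, fun k hk => ?_⟩
    · rw [Pi.add_apply, sum_single_apply, sum_single_apply, if_pos hk,
        if_neg (Finset.disjoint_right.1 hdis hk), zero_add]
      exact hc k
    · rw [Pi.add_apply, sum_single_apply, sum_single_apply,
        if_neg (Finset.mem_sdiff.1 hk).2, add_zero]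
  · rintro ⟨h1, h2⟩
    refine ⟨fun k => if k ∈ D then chart τ.dirs (y - τ.pos) k else 0, fun i => ?_, ?_⟩
    · dsimp only
      split_ifs with h
      · exact h1 i h
      · norm_num
    · have hy := sum_chart_smul τ.card_dirs (y - τ.pos)
      rw [← Finset.sum_sdiff hD, Finset.sum_congr rfl (fun k hk => by rw [h2 k hk])] at hy
      have e1 : ∑ i ∈ U, v i = ∑ k ∈ τ.dirs \ D, (if k ∈ U then (1 : ℝ) else 0) • v k := by
        simp only [ite_smul, one_smul, zero_smul]
        rw [← Finset.sum_filter, Finset.filter_mem_eq_inter, Finset.inter_eq_right.2 hU]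
      have e2 : ∑ i ∈ D, (if i ∈ D then chart τ.dirs (y - τ.pos) i else 0) • v i =
          ∑ i ∈ D, chart τ.dirs (y - τ.pos) i • v i :=
        Finset.sum_congr rfl fun k hk => by rw [if_pos hk]
      rw [e2, Tile.corner, e1, add_assoc, hy, add_sub_cancel]

lemma Tile.mem_carrier_iff (τ : Tile) (y : Fin 3 → ℝ) :
    y ∈ τ.carrier ↔
      ∀ k, 0 ≤ chart τ.dirs (y - τ.pos) k ∧ chart τ.dirs (y - τ.pos) k ≤ 1 := by
  have := τ.mem_face_iff (D := τ.dirs) (U := ∅) subset_rfl (by simp) y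
  simp only [Tile.corner, Finset.sum_empty, add_zero, Finset.sdiff_self, Finset.notMem_empty,
    false_imp_iff, implies_true, and_true] at this
  rw [Tile.carrier, this]
  refine ⟨fun h k => ?_, fun h k _ => h k⟩
  by_cases hk : k ∈ τ.dirs
  · exact h k hk
  · rw [chart_of_notMem τ.card_dirs hk]; norm_num

lemma Tile.isClosed_carrier (τ : Tile) : IsClosed τ.carrier := by
  have : τ.carrier =
      (fun y => chart τ.dirs (y - τ.pos)) ⁻¹' Set.Icc (0 : Fin 6 → ℝ) 1 := by
    ext y
    rw [τ.mem_carrier_iff, Set.mem_preimage, Set.mem_Icc, Pi.le_def, Pi.le_def, ← forall_and]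
    rfl
  rw [this]
  exact isClosed_Icc.preimage (by fun_prop)

lemma Tile.convex_carrier (τ : Tile) : Convex ℝ τ.carrier := by
  intro x hx y hy a b ha hb hab
  rw [τ.mem_carrier_iff] at hx hy ⊢
  intro k
  have : a • x + b • y - τ.pos = a • (x - τ.pos) + b • (y - τ.pos) := by
    obtain rfl : b = 1 - a := by linarith
    module
  rw [this, map_add, map_smul, map_smul]
  simp only [Pi.add_apply, Pi.smul_apply, smul_eq_mul]
  obtain ⟨h1, h2⟩ := hx k
  obtain ⟨h3, h4⟩ := hy k
  constructor
  · positivity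
  · nlinarith

lemma Tile.chart_corner_sub (τ : Tile) {U : Finset (Fin 6)} (hU : U ⊆ τ.dirs) :
    chart τ.dirs (τ.corner U - τ.pos) = ∑ i ∈ U, Pi.single i 1 := by
  rw [← chart_sum τ.card_dirs hU (fun _ => 1)]
  simp [Tile.corner]

lemma Tile.corner_mem_carrier (τ : Tile) {U : Finset (Fin 6)} (hU : U ⊆ τ.dirs) :
    τ.corner U ∈ τ.carrier := by
  rw [τ.mem_carrier_iff, τ.chart_corner_sub hU]
  intro k
  rw [sum_single_apply U (fun _ => 1)]
  split_ifs <;> norm_num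

lemma Tile.pos_mem_carrier (τ : Tile) : τ.pos ∈ τ.carrier := by
  simpa [Tile.corner] using τ.corner_mem_carrier (U := ∅) (by simp)

lemma Tiling.chart_sub_eq (T : Tiling) {σ τ : Tile} (hσ : σ ∈ T.tiles) (hτ : τ ∈ T.tiles)
    {x y : Fin 3 → ℝ} (hxσ : x ∈ σ.carrier) (hxτ : x ∈ τ.carrier) (hyσ : y ∈ σ.carrier)
    (hyτ : y ∈ τ.carrier) : chart σ.dirs (y - x) = chart τ.dirs (y - x) := by
  rcases eq_or_ne σ τ with rfl | hne
  · rfl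
  obtain ⟨D, -, ⟨hDσ, U, hU, hF⟩, ⟨hDτ, -⟩⟩ := T.face_to_face σ hσ τ hτ hne ⟨x, hxσ, hxτ⟩
  have hx : x ∈ σ.carrier ∩ τ.carrier := ⟨hxσ, hxτ⟩
  have hy : y ∈ σ.carrier ∩ τ.carrier := ⟨hyσ, hyτ⟩
  rw [hF] at hx hy
  obtain ⟨c, -, rfl⟩ := hx
  obtain ⟨c', -, rfl⟩ := hy
  rw [add_sub_add_left_eq_sub, ← Finset.sum_sub_distrib]
  simp_rw [← sub_smul]
  rw [chart_sum σ.card_dirs hDσ (fun i => c' i - c i),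
    chart_sum τ.card_dirs hDτ (fun i => c' i - c i)]

end Golden

namespace Golden

lemma exists_norm_chart_le :
    ∃ K : ℝ, 0 < K ∧ ∀ (D : Finset (Fin 6)) (w : Fin 3 → ℝ), ‖chart D w‖ ≤ K * ‖w‖ := by
  refine ⟨1 + ∑ D : Finset (Fin 6), ‖chart D‖, by positivity, fun D w => ?_⟩
  refine ((chart D).le_opNorm w).trans (mul_le_mul_of_nonneg_right ?_ (norm_nonneg w))
  have := Finset.single_le_sum (f := fun D : Finset (Fin 6) => ‖chart D‖)
    (fun _ _ => norm_nonneg _) (Finset.mem_univ D)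
  linarith

lemma Tiling.eq_of_floor_eq (T : Tiling) {σ τ : Tile} (hσ : σ ∈ T.tiles) (hτ : τ ∈ T.tiles)
    (hdirs : σ.dirs = τ.dirs)
    (hfl : ∀ k, ⌊chart σ.dirs σ.pos k⌋ = ⌊chart σ.dirs τ.pos k⌋) : σ = τ := by
  by_contra hne
  set w : Fin 6 → ℝ := chart σ.dirs (τ.pos - σ.pos) with hw
  have hw1 : ∀ k, |w k| < 1 := fun k => by
    rw [hw, map_sub, Pi.sub_apply, abs_sub_comm]
    exact Int.abs_sub_lt_one_of_floor_eq_floor (hfl k)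
  have hw0 : ∀ k, k ∉ σ.dirs → w k = 0 := fun k hk => chart_of_notMem σ.card_dirs hk _
  have key : ∀ c : Fin 6 → ℝ, ∀ k,
      chart σ.dirs (σ.pos + ∑ i ∈ σ.dirs, c i • v i - σ.pos) k = if k ∈ σ.dirs then c k else 0 := by
    intro c k
    rw [add_sub_cancel_left, chart_sum σ.card_dirs subset_rfl, sum_single_apply]
  have key' : ∀ c : Fin 6 → ℝ, ∀ k, chart σ.dirs (σ.pos + ∑ i ∈ σ.dirs, c i • v i - τ.pos) k =
      (if k ∈ σ.dirs then c k else 0) - w k := by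
    intro c k
    rw [← key c k, hw, ← Pi.sub_apply, ← map_sub, sub_sub, add_sub_cancel]
  have hmem : ∀ c : Fin 6 → ℝ, (∀ k, max 0 (w k) ≤ c k ∧ c k ≤ min 1 (1 + w k)) →
      σ.pos + ∑ i ∈ σ.dirs, c i • v i ∈ σ.carrier ∩ τ.carrier := by
    intro c hc
    constructor
    · rw [σ.mem_carrier_iff]
      intro k
      rw [key c k]
      split_ifs
      · exact ⟨(le_max_left _ _).trans (hc k).1, (hc k).2.trans (min_le_left _ _)⟩
      · norm_num
    · rw [τ.mem_carrier_iff, ← hdirs]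
      intro k
      rw [key' c k]
      split_ifs with h
      · have h1 := (le_max_right _ _).trans (hc k).1
        have h2 := (hc k).2.trans (min_le_right _ _)
        constructor <;> linarith
      · rw [hw0 k h]; norm_num
  have hlt : ∀ k, max 0 (w k) < min 1 (1 + w k) := fun k => by
    have := abs_lt.1 (hw1 k)
    rw [max_lt_iff, lt_min_iff, lt_min_iff]
    refine ⟨⟨?_, ?_⟩, ?_, ?_⟩ <;> linarith
  have h1 := hmem (fun k => max 0 (w k)) fun k => ⟨le_rfl, (hlt k).le⟩
  have h2 := hmem (fun k => min 1 (1 + w k)) fun k => ⟨(hlt k).le, le_rfl⟩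
  obtain ⟨D, hD, ⟨hDσ, U, hU, hF⟩, -⟩ := T.face_to_face σ hσ τ hτ hne ⟨_, h1⟩
  obtain ⟨l, hlσ, hlD⟩ : ∃ l ∈ σ.dirs, l ∉ D := by
    by_contra! h
    have := Finset.card_le_card (show σ.dirs ⊆ D from h)
    have := σ.card_dirs
    omega
  rw [hF, σ.mem_face_iff hDσ hU] at h1 h2
  have h3 := h1.2 l (Finset.mem_sdiff.2 ⟨hlσ, hlD⟩)
  have h4 := h2.2 l (Finset.mem_sdiff.2 ⟨hlσ, hlD⟩)
  rw [key, if_pos hlσ] at h3 h4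
  exact (hlt l).ne (h3.trans h4.symm)

lemma Tiling.finite_meeting (T : Tiling) (p : Fin 3 → ℝ) (R : ℝ) :
    {τ ∈ T.tiles | (τ.carrier ∩ Metric.ball p R).Nonempty}.Finite := by
  obtain ⟨K, hK, hb⟩ := exists_norm_chart_le
  let Φ : Tile → Finset (Fin 6) × (Fin 6 → ℤ) :=
    fun τ => (τ.dirs, fun k => ⌊chart τ.dirs τ.pos k⌋)
  set N : ℤ := ⌈K * (‖p‖ + R) + 1⌉ + 1
  refine Set.Finite.of_finite_image (f := Φ) (Set.Finite.subset
    (Set.finite_univ.prod (Set.finite_Icc (fun _ => -N : Fin 6 → ℤ) (fun _ => N))) ?_) ?_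
  · rintro _ ⟨τ, ⟨-, y, hy, hyp⟩, rfl⟩
    have hy' : ‖y‖ ≤ ‖p‖ + R := by
      have := norm_sub_norm_le y p
      rw [Metric.mem_ball, dist_eq_norm] at hyp
      linarith
    have hk : ∀ k, |chart τ.dirs τ.pos k| ≤ K * (‖p‖ + R) + 1 := fun k => by
      have h1 := (τ.mem_carrier_iff y).1 hy k
      have h2 : |chart τ.dirs y k| ≤ K * (‖p‖ + R) :=
        ((norm_le_pi_norm (chart τ.dirs y) k).trans (hb _ y)).trans
          (mul_le_mul_of_nonneg_left hy' hK.le)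
      rw [map_sub, Pi.sub_apply] at h1
      rw [abs_le] at h2 ⊢
      constructor <;> linarith
    have hN : K * (‖p‖ + R) + 1 ≤ N - 1 := by
      have := Int.le_ceil (K * (‖p‖ + R) + 1)
      simp only [N]; push_cast; linarith
    refine ⟨Set.mem_univ _, fun k => ?_, fun k => ?_⟩
    · have := (abs_le.1 (hk k)).1
      apply Int.le_floor.2
      push_cast
      linarith
    · have h1 := (abs_le.1 (hk k)).2
      have h2 := Int.floor_le (chart τ.dirs τ.pos k)
      have : ((⌊chart τ.dirs τ.pos k⌋ : ℤ) : ℝ) ≤ (N : ℝ) := by linarith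
      exact_mod_cast this
  · rintro σ ⟨hσ, -⟩ τ ⟨hτ, -⟩ h
    have hd : σ.dirs = τ.dirs := congrArg Prod.fst h
    refine T.eq_of_floor_eq hσ hτ hd fun k => ?_
    have := congrFun (congrArg Prod.snd h) k
    simp only [Φ] at this
    rw [this, hd]

lemma Tiling.exists_star_radius (T : Tiling) (p : Fin 3 → ℝ) :
    ∃ r > 0, ∀ τ ∈ T.tiles, (τ.carrier ∩ Metric.ball p r).Nonempty → p ∈ τ.carrier := by
  have hfin : {τ ∈ T.tiles | (τ.carrier ∩ Metric.ball p 1).Nonempty ∧ p ∉ τ.carrier}.Finite :=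
    (T.finite_meeting p 1).subset fun τ h => ⟨h.1, h.2.1⟩
  have hcl : IsClosed (⋃ τ ∈ {τ ∈ T.tiles |
      (τ.carrier ∩ Metric.ball p 1).Nonempty ∧ p ∉ τ.carrier}, τ.carrier) :=
    hfin.isClosed_biUnion fun τ _ => τ.isClosed_carrier
  obtain ⟨r, hr, hsub⟩ := Metric.isOpen_iff.1 hcl.isOpen_compl p (by simp)
  refine ⟨min r 1, by positivity, fun τ hτ ⟨y, hy, hyr⟩ => ?_⟩
  by_contra hp
  have h1 : y ∈ Metric.ball p 1 := Metric.ball_subset_ball (min_le_right _ _) hyr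
  exact hsub (Metric.ball_subset_ball (min_le_left _ _) hyr)
    (Set.mem_biUnion (x := τ) ⟨hτ, ⟨y, hy, h1⟩, hp⟩ hy)

lemma Tiling.exists_mem (T : Tiling) (x : Fin 3 → ℝ) : ∃ τ ∈ T.tiles, x ∈ τ.carrier := by
  have : x ∈ ⋃ τ ∈ T.tiles, τ.carrier := T.covers ▸ Set.mem_univ x
  simpa using this

end Golden

section Potential

open Filter Topology

variable {X V W : Type*} [AddCommGroup W]

/-- On `s`, the increments of `g` between nearby points are given by `D`. -/
def IsPotentialOn [TopologicalSpace X] (D : X → X → W) (g : X → W) (s : Set X) : Prop :=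
  ∀ x ∈ s, ∀ᶠ y in 𝓝[s] x, g y - g x = D x y

lemma IsPotentialOn.mono [TopologicalSpace X] {D : X → X → W} {g : X → W} {s t : Set X}
    (h : IsPotentialOn D g t) (hst : s ⊆ t) : IsPotentialOn D g s :=
  fun x hx => (h x (hst hx)).filter_mono (nhdsWithin_mono x hst)

lemma IsPotentialOn.add_const [TopologicalSpace X] {D : X → X → W} {g : X → W} {s : Set X}
    (h : IsPotentialOn D g s) (c : W) : IsPotentialOn D (fun x => g x + c) s :=
  fun x hx => (h x hx).mono fun y hy => by rw [add_sub_add_right_eq_sub, hy]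

lemma IsPotentialOn.sub_eq_sub [TopologicalSpace X] {D : X → X → W} {g g' : X → W} {s : Set X}
    (h : IsPotentialOn D g s) (h' : IsPotentialOn D g' s) (hs : IsPreconnected s) {x y : X}
    (hx : x ∈ s) (hy : y ∈ s) : g y - g x = g' y - g' x := by
  refine hs.induction₂ (fun x y => g y - g x = g' y - g' x)
    (fun x hx => ((h x hx).and (h' x hx)).mono fun y hy => hy.1.trans hy.2.symm)
    (fun x y z _ _ _ h1 h2 => ?_) (fun x y _ _ h1 => ?_) hx hy
  · rw [← sub_add_sub_cancel (g z) (g y) (g x), h1, h2, sub_add_sub_cancel]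
  · rw [← neg_sub, h1, neg_sub]

lemma IsPotentialOn.union_slab [TopologicalSpace X] {D : ℝ × X → ℝ × X → W} {g₁ g₂ : ℝ × X → W}
    {a b c : ℝ} {B : Set X} (hab : a ≤ b) (hbc : b ≤ c) (hB : IsPreconnected B)
    (h₁ : IsPotentialOn D g₁ (Set.Icc a b ×ˢ B)) (h₂ : IsPotentialOn D g₂ (Set.Icc b c ×ˢ B)) :
    ∃ g, IsPotentialOn D g (Set.Icc a c ×ˢ B) := by
  classical
  rcases B.eq_empty_or_nonempty with rfl | ⟨x₀, hx₀⟩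
  · exact ⟨g₁, by simp [IsPotentialOn]⟩
  set g₃ : ℝ × X → W := fun z => g₂ z + (g₁ (b, x₀) - g₂ (b, x₀)) with hg₃
  have h₃ : IsPotentialOn D g₃ (Set.Icc b c ×ˢ B) := h₂.add_const _
  have hagree : ∀ y ∈ B, g₃ (b, y) = g₁ (b, y) := by
    intro y hy
    have hs1 : ({b} : Set ℝ) ×ˢ B ⊆ Set.Icc a b ×ˢ B :=
      Set.prod_mono (by simpa using hab) subset_rfl
    have hs2 : ({b} : Set ℝ) ×ˢ B ⊆ Set.Icc b c ×ˢ B :=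
      Set.prod_mono (by simpa using hbc) subset_rfl
    have := (h₃.mono hs2).sub_eq_sub (h₁.mono hs1) (isPreconnected_singleton.prod hB)
      (x := (b, x₀)) (y := (b, y)) (by simp [hx₀]) (by simp [hy])
    have h0 : g₃ (b, x₀) = g₁ (b, x₀) := by simp [hg₃]
    rw [h0] at this
    exact sub_left_injective this
  let g : ℝ × X → W := fun z => if z.1 ≤ b then g₁ z else g₃ z
  have e1 : ∀ z ∈ Set.Icc a b ×ˢ B, g z = g₁ z := fun z hz => if_pos hz.1.2
  have e2 : ∀ z ∈ Set.Icc b c ×ˢ B, g z = g₃ z := by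
    rintro ⟨u, y⟩ ⟨⟨hu, -⟩, hy⟩
    by_cases h : u ≤ b
    · obtain rfl : u = b := le_antisymm h hu
      simp [g, hagree y hy]
    · simp [g, h]
  have p1 : IsPotentialOn D g (Set.Icc a b ×ˢ B) := fun x hx => by
    filter_upwards [h₁ x hx, self_mem_nhdsWithin] with y hy hys
    rw [e1 x hx, e1 y hys, hy]
  have p2 : IsPotentialOn D g (Set.Icc b c ×ˢ B) := fun x hx => by
    filter_upwards [h₃ x hx, self_mem_nhdsWithin] with y hy hys
    rw [e2 x hx, e2 y hys, hy]
  have hun : Set.Icc a c ×ˢ B = Set.Icc a b ×ˢ B ∪ Set.Icc b c ×ˢ B := by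
    rw [← Set.union_prod, Set.Icc_union_Icc_eq_Icc hab hbc]
  refine ⟨g, fun z hz => ?_⟩
  rw [hun, nhdsWithin_union, eventually_sup]
  obtain ⟨u, y⟩ := z
  obtain ⟨⟨hu1, hu2⟩, hy⟩ := hz
  simp only at hu1 hu2 hy
  constructor
  · by_cases h : u ≤ b
    · exact p1 _ ⟨⟨hu1, h⟩, hy⟩
    · have : ∀ᶠ z in 𝓝[Set.Icc a b ×ˢ B] (u, y), False := by
        have hne : ∀ᶠ z : ℝ × X in 𝓝 (u, y), b < z.1 :=
          continuous_fst.continuousAt.eventually (lt_mem_nhds (not_le.1 h))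
        filter_upwards [nhdsWithin_le_nhds hne, self_mem_nhdsWithin] with z h1 h2
        exact absurd h2.1.2 (not_le.2 h1)
      exact this.mono fun _ h => h.elim
  · by_cases h : b ≤ u
    · exact p2 _ ⟨⟨h, hu2⟩, hy⟩
    · have : ∀ᶠ z in 𝓝[Set.Icc b c ×ˢ B] (u, y), False := by
        have hne : ∀ᶠ z : ℝ × X in 𝓝 (u, y), z.1 < b :=
          continuous_fst.continuousAt.eventually (gt_mem_nhds (not_le.1 h))
        filter_upwards [nhdsWithin_le_nhds hne, self_mem_nhdsWithin] with z h1 h2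
        exact absurd h2.1.1 (not_le.2 h1)
      exact this.mono fun _ h => h.elim

/-- A closed system of local increments on a normed space has a global potential. -/
theorem exists_isPotentialOn_univ [NormedAddCommGroup V] [NormedSpace ℝ V] (D : V → V → W)
    (hD : ∀ p, ∃ r > 0, ∀ x ∈ Metric.ball p r, ∀ᶠ y in 𝓝 x, D p y - D p x = D x y) :
    ∃ f : V → W, ∀ x, ∀ᶠ y in 𝓝 x, f y - f x = D x y := by
  let m : ℝ × V → V := fun z => z.1 • z.2
  have hm : Continuous m := by fun_prop
  let D' : ℝ × V → ℝ × V → W := fun z z' => D (m z) (m z')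
  have hD' : ∀ p, ∃ r > 0, IsPotentialOn D' (D' p) (Metric.ball p r) := by
    intro p
    obtain ⟨r, hr, h⟩ := hD (m p)
    obtain ⟨r', hr', h'⟩ := Metric.continuous_iff.1 hm p r hr
    exact ⟨r', hr', fun x hx =>
      nhdsWithin_le_nhds (hm.continuousAt.eventually (h (m x) (h' x hx)))⟩
  have hself : ∀ x, D x x = 0 := fun x => by
    obtain ⟨r, hr, h⟩ := hD x
    have := (h x (Metric.mem_ball_self hr)).self_of_nhds
    rw [← this, sub_self]
  have hcone : ∀ x : V, ∃ δ > 0, ∃ g, IsPotentialOn D' g (Set.Icc 0 1 ×ˢ Metric.ball x δ) := by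
    intro x
    choose r hr hpot using hD'
    obtain ⟨δ, hδ, hleb⟩ := lebesgue_number_lemma_of_metric
      (isCompact_Icc.prod isCompact_singleton : IsCompact (Set.Icc (0 : ℝ) 1 ×ˢ ({x} : Set V)))
      (c := fun p => Metric.ball p (r p)) (fun p => Metric.isOpen_ball)
      (fun z _ => Set.mem_iUnion.2 ⟨z, Metric.mem_ball_self (hr z)⟩)
    obtain ⟨N, hN⟩ := exists_nat_one_div_lt hδ
    have hN0 : (0 : ℝ) < N + 1 := by positivity
    have step : ∀ i : ℕ, i ≤ N + 1 →
        ∃ g, IsPotentialOn D' g (Set.Icc (0 : ℝ) ((i : ℝ) / (N + 1)) ×ˢ Metric.ball x δ) := by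
      have slab : ∀ i : ℕ, i < N + 1 → ∃ g, IsPotentialOn D' g
          (Set.Icc ((i : ℝ) / (N + 1)) ((i + 1 : ℕ) / (N + 1)) ×ˢ Metric.ball x δ) := by
        intro i hi
        have hi1 : (i : ℝ) / (N + 1) ≤ 1 := by
          rw [div_le_one hN0]; exact_mod_cast hi.le
        obtain ⟨p, hp⟩ := hleb ((i : ℝ) / (N + 1), x) ⟨⟨by positivity, hi1⟩, rfl⟩
        refine ⟨D' p, (hpot p).mono (Set.Subset.trans ?_ hp)⟩
        rintro ⟨u, y⟩ ⟨⟨hu1, hu2⟩, hy⟩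
        rw [Metric.mem_ball, Prod.dist_eq, max_lt_iff]
        refine ⟨?_, hy⟩
        rw [Real.dist_eq, abs_of_nonneg (sub_nonneg.2 hu1)]
        have : ((i + 1 : ℕ) : ℝ) / (N + 1) = i / (N + 1) + 1 / (N + 1) := by push_cast; ring
        dsimp only at hu2
        linarith
      intro i
      induction i with
      | zero =>
        intro _
        obtain ⟨g, hg⟩ := slab 0 (Nat.succ_pos N)
        refine ⟨g, hg.mono (Set.prod_mono (Set.Icc_subset_Icc (by simp) ?_) subset_rfl)⟩
        simp only [Nat.cast_zero, zero_div]
        positivity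
      | succ i ih =>
        intro hi
        obtain ⟨g₁, h₁⟩ := ih (by omega)
        obtain ⟨g₂, h₂⟩ := slab i (by omega)
        exact h₁.union_slab (by positivity) (by gcongr; omega)
          (convex_ball x δ).isPreconnected h₂
    obtain ⟨g, hg⟩ := step (N + 1) le_rfl
    refine ⟨δ, hδ, g, ?_⟩
    rwa [show ((N + 1 : ℕ) : ℝ) / (N + 1) = 1 by push_cast; exact div_self hN0.ne'] at hg
  choose δ hδ g hg using hcone
  have hzero : ∀ x, ∀ y ∈ Metric.ball x (δ x), g x (0, y) = g x (0, x) := by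
    intro x y hy
    have h1 := (hg x).mono (s := {0} ×ˢ Metric.ball x (δ x))
      (Set.prod_mono (by simp) subset_rfl)
    have h2 : IsPotentialOn D' (fun _ => 0) (({0} : Set ℝ) ×ˢ Metric.ball x (δ x)) := by
      intro z hz
      filter_upwards [self_mem_nhdsWithin] with z' hz'
      have e : m z = 0 := by simp [m, Set.mem_singleton_iff.1 hz.1]
      have e' : m z' = 0 := by simp [m, Set.mem_singleton_iff.1 hz'.1]
      simp only [D', e, e', hself, sub_zero]
    have := h1.sub_eq_sub h2 (isPreconnected_singleton.prod (convex_ball x _).isPreconnected)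
      (x := (0, x)) (y := (0, y)) (by simp [hδ x]) (by simpa using hy)
    simpa [sub_eq_zero] using this
  have hray : ∀ x, ∀ y ∈ Metric.ball x (δ x),
      g y (1, y) - g y (0, y) = g x (1, y) - g x (0, x) := by
    intro x y hy
    rw [← hzero x y hy]
    exact ((hg y).mono (Set.prod_mono subset_rfl (by simpa using hδ y))).sub_eq_sub
      ((hg x).mono (Set.prod_mono subset_rfl (by simpa using hy)))
      (isPreconnected_Icc.prod isPreconnected_singleton) (by simp : ((0 : ℝ), y) ∈ _ ×ˢ {y})
      (by simp)
  refine ⟨fun x => g x (1, x) - g x (0, x), fun x => ?_⟩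
  have hx := hg x (1, x) ⟨by simp, Metric.mem_ball_self (hδ x)⟩
  have ht : Tendsto (fun y : V => ((1 : ℝ), y)) (𝓝 x)
      (𝓝[Set.Icc 0 1 ×ˢ Metric.ball x (δ x)] (1, x)) := by
    refine tendsto_nhdsWithin_iff.2
      ⟨(Continuous.prodMk_right (1 : ℝ)).continuousAt, ?_⟩
    filter_upwards [Metric.ball_mem_nhds x (hδ x)] with y hy
    exact ⟨by simp, hy⟩
  filter_upwards [ht.eventually hx, Metric.ball_mem_nhds x (hδ x)] with y h1 h2
  rw [hray x y h2, sub_sub_sub_cancel_right, h1]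
  simp [D', m]

end Potential

namespace Golden

open Filter Topology

/-- On each tile, `f` is affine and maps the edges `v i` of the tile to `e i`. -/
def Tiling.IsUnfolding (T : Tiling) (f : (Fin 3 → ℝ) → (Fin 6 → ℝ)) : Prop :=
  ∀ τ ∈ T.tiles, ∀ x ∈ τ.carrier, ∀ y ∈ τ.carrier, f y - f x = chart τ.dirs (y - x)

open Classical in
theorem Tiling.exists_isUnfolding (T : Tiling) : ∃ f, T.IsUnfolding f := by
  let D : (Fin 3 → ℝ) → (Fin 3 → ℝ) → (Fin 6 → ℝ) := fun x y =>
    if h : ∃ τ ∈ T.tiles, x ∈ τ.carrier ∧ y ∈ τ.carrier then chart h.choose.dirs (y - x) else 0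
  have hD : ∀ τ ∈ T.tiles, ∀ x ∈ τ.carrier, ∀ y ∈ τ.carrier, D x y = chart τ.dirs (y - x) := by
    intro τ hτ x hx y hy
    have h : ∃ τ ∈ T.tiles, x ∈ τ.carrier ∧ y ∈ τ.carrier := ⟨τ, hτ, hx, hy⟩
    obtain ⟨h1, h2, h3⟩ := h.choose_spec
    simp only [D]
    rw [dif_pos h]
    exact T.chart_sub_eq h1 hτ h2 hx h3 hy
  obtain ⟨f, hf⟩ := exists_isPotentialOn_univ D (fun p => by
    obtain ⟨r, hr, hstar⟩ := T.exists_star_radius p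
    refine ⟨r, hr, fun x hx => ?_⟩
    obtain ⟨r', hr', hstar'⟩ := T.exists_star_radius x
    filter_upwards [Metric.isOpen_ball.mem_nhds hx, Metric.ball_mem_nhds x hr'] with y hy hy'
    obtain ⟨τ, hτ, hyτ⟩ := T.exists_mem y
    have hpτ := hstar τ hτ ⟨y, hyτ, hy⟩
    have hxτ := hstar' τ hτ ⟨y, hyτ, hy'⟩
    rw [hD τ hτ p hpτ y hyτ, hD τ hτ p hpτ x hxτ, hD τ hτ x hxτ y hyτ, ← map_sub,
      sub_sub_sub_cancel_right])
  refine ⟨f, fun τ hτ x hx y hy => ?_⟩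
  have h1 : IsPotentialOn D f τ.carrier := fun x _ => nhdsWithin_le_nhds (hf x)
  have h2 : IsPotentialOn D (chart τ.dirs) τ.carrier := fun x hx => by
    filter_upwards [self_mem_nhdsWithin] with y hy
    rw [hD τ hτ x hx y hy, map_sub]
  rw [h1.sub_eq_sub h2 τ.convex_carrier.isPreconnected hx hy, map_sub]

lemma Tiling.IsUnfolding.eventually_sub_eq {T : Tiling} {f : (Fin 3 → ℝ) → (Fin 6 → ℝ)}
    (hf : T.IsUnfolding f) (x : Fin 3 → ℝ) :
    ∀ᶠ y in 𝓝 x, ∃ τ ∈ T.tiles, f y - f x = chart τ.dirs (y - x) := by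
  obtain ⟨r, hr, hstar⟩ := T.exists_star_radius x
  filter_upwards [Metric.ball_mem_nhds x hr] with y hy
  obtain ⟨τ, hτ, hyτ⟩ := T.exists_mem y
  exact ⟨τ, hτ, hf τ hτ x (hstar τ hτ ⟨y, hyτ, hy⟩) y hyτ⟩

lemma Tiling.IsUnfolding.sum_smul {T : Tiling} {f : (Fin 3 → ℝ) → (Fin 6 → ℝ)}
    (hf : T.IsUnfolding f) (x y : Fin 3 → ℝ) : ∑ k, (f y k - f x k) • v k = y - x := by
  refine isPreconnected_univ.induction₂ (fun x y => ∑ k, (f y k - f x k) • v k = y - x)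
    (fun x _ => ?_) (fun x y z _ _ _ h1 h2 => ?_) (fun x y _ _ h => ?_) (Set.mem_univ x)
    (Set.mem_univ y)
  · rw [nhdsWithin_univ]
    filter_upwards [hf.eventually_sub_eq x] with y ⟨τ, _, h⟩
    rw [← sum_univ_chart_smul τ.card_dirs (y - x), ← h]
    rfl
  · rw [← sub_add_sub_cancel z y x, ← h1, ← h2, ← Finset.sum_add_distrib]
    refine Finset.sum_congr rfl fun k _ => ?_
    rw [← add_smul, sub_add_sub_cancel]
  · rw [← neg_sub, ← h, ← Finset.sum_neg_distrib]
    refine Finset.sum_congr rfl fun k _ => ?_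
    rw [← neg_smul, neg_sub]

lemma norm_sub_le_of_eventually {V W : Type*} [NormedAddCommGroup V] [NormedSpace ℝ V]
    [NormedAddCommGroup W] {f : V → W} {K : ℝ}
    (hf : ∀ x, ∀ᶠ y in 𝓝 x, ‖f y - f x‖ ≤ K * ‖y - x‖) (x y : V) :
    ‖f y - f x‖ ≤ K * ‖y - x‖ := by
  have hcont : Continuous f := by
    refine continuous_iff_continuousAt.2 fun x => ?_
    rw [ContinuousAt, tendsto_iff_norm_sub_tendsto_zero]
    have h0 : Tendsto (fun y => K * ‖y - x‖) (𝓝 x) (𝓝 0) := by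
      have : Continuous fun y => K * ‖y - x‖ := by fun_prop
      simpa using this.tendsto x
    exact squeeze_zero' (Eventually.of_forall fun _ => norm_nonneg _) (hf x) h0
  let γ : ℝ → V := fun t => x + t • (y - x)
  have hγ : Continuous γ := by fun_prop
  have hγs : ∀ s t, γ t - γ s = (t - s) • (y - x) := fun s t => by simp only [γ]; module
  have key : Set.Icc (0 : ℝ) 1 ⊆ {t | ‖f (γ t) - f (γ 0)‖ ≤ K * (t * ‖y - x‖)} := by
    refine IsClosed.Icc_subset_of_forall_exists_gt ?_ (by simp) ?_
    · exact (isClosed_le (by fun_prop) (by fun_prop)).inter isClosed_Icc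
    · rintro t ⟨ht, -⟩ b hb
      have h1 : ∀ᶠ s in 𝓝[>] t, ‖f (γ s) - f (γ t)‖ ≤ K * ‖γ s - γ t‖ :=
        nhdsWithin_le_nhds (hγ.continuousAt.eventually (hf (γ t)))
      obtain ⟨s, hs, hsI⟩ := (h1.and (Ioc_mem_nhdsGT hb)).exists
      refine ⟨s, ?_, hsI⟩
      rw [hγs, norm_smul, Real.norm_eq_abs, abs_of_pos (sub_pos.2 hsI.1)] at hs
      have := norm_sub_le_norm_sub_add_norm_sub (f (γ s)) (f (γ t)) (f (γ 0))
      simp only [Set.mem_ofPred_eq] at ht ⊢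
      linarith
  have := key ⟨zero_le_one, le_rfl⟩
  simpa [γ] using this

lemma Tiling.IsUnfolding.exists_lipschitz {T : Tiling} {f : (Fin 3 → ℝ) → (Fin 6 → ℝ)}
    (hf : T.IsUnfolding f) : ∃ K, 0 < K ∧ ∀ x y, ‖f y - f x‖ ≤ K * ‖y - x‖ := by
  obtain ⟨K, hK, hb⟩ := exists_norm_chart_le
  refine ⟨K, hK, norm_sub_le_of_eventually fun x => ?_⟩
  filter_upwards [hf.eventually_sub_eq x] with y ⟨τ, _, h⟩
  rw [h]
  exact hb _ _

/-- Rounding an unfolding to integers gives a lift. -/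
lemma Tiling.IsUnfolding.isLift_floor {T : Tiling} {f : (Fin 3 → ℝ) → (Fin 6 → ℝ)}
    (hf : T.IsUnfolding f) {x₀ : Fin 3 → ℝ} (hx₀ : x₀ ∈ T.vertices) :
    T.IsLift fun x k => ⌊f x k⌋ - ⌊f x₀ k⌋ := by
  refine ⟨⟨x₀, hx₀, by ext k; simp⟩, fun τ hτ U hU => ?_⟩
  have h := hf τ hτ _ τ.pos_mem_carrier _ (τ.corner_mem_carrier hU)
  rw [τ.chart_corner_sub hU, sub_eq_iff_eq_add] at h
  ext k
  have hk : f (τ.corner U) k = f τ.pos k + ((∑ i ∈ U, Pi.single i 1 : Fin 6 → ℤ) k : ℤ) := by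
    rw [h, Pi.add_apply, add_comm, Finset.sum_apply, Finset.sum_apply]
    push_cast
    congr 1
    refine Finset.sum_congr rfl fun i _ => ?_
    simp [Pi.single_apply]
  rw [Pi.add_apply]
  dsimp only
  rw [hk, Int.floor_add_intCast]
  ring

end Golden

namespace Golden

/-- The base point of the lower face, generated by `v i` and `v j`, of a tile with directions
`i, j, k`; the height is measured along the normal vector. -/
noncomputable def Tile.lowerBase (i j k : Fin 6) (τ : Tile) : Fin 3 → ℝ :=
  if 0 < normal i j ⬝ᵥ v k then τ.pos else τ.pos + v k

/-- The base point of the upper face, generated by `v i` and `v j`, of a tile with directions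
`i, j, k`. -/
noncomputable def Tile.upperBase (i j k : Fin 6) (τ : Tile) : Fin 3 → ℝ :=
  if 0 < normal i j ⬝ᵥ v k then τ.pos + v k else τ.pos

section

variable {i j k : Fin 6}

lemma Tile.lowerBase_swap (hij : i ≠ j) (hki : k ≠ i) (hkj : k ≠ j) (τ : Tile) :
    τ.lowerBase j i k = τ.upperBase i j k := by
  have := triple_ne_zero hij hki hkj
  rw [lowerBase, upperBase, normal_swap, neg_dotProduct]
  split_ifs with h1 h2 h2
  · linarith
  · rfl
  · rfl
  · exact absurd (le_antisymm (not_lt.1 h2) (by linarith)) this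

lemma Tile.upperBase_swap (hij : i ≠ j) (hki : k ≠ i) (hkj : k ≠ j) (τ : Tile) :
    τ.upperBase j i k = τ.lowerBase i j k :=
  (τ.lowerBase_swap hij.symm hkj hki).symm

lemma Tile.dot_eq (hij : i ≠ j) (hki : k ≠ i) (hkj : k ≠ j) {τ : Tile} (hτ : τ.dirs = {i, j, k})
    (y : Fin 3 → ℝ) : normal i j ⬝ᵥ y =
      normal i j ⬝ᵥ τ.pos + chart τ.dirs (y - τ.pos) k * (normal i j ⬝ᵥ v k) := by
  have h := sum_chart_smul τ.card_dirs (y - τ.pos)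
  nth_rewrite 1 [hτ] at h
  rw [Finset.sum_insert (by simp [hij, hki.symm]), Finset.sum_insert (by simp [hkj.symm]),
    Finset.sum_singleton, eq_sub_iff_add_eq] at h
  nth_rewrite 1 [← h]
  simp only [dotProduct_add, dotProduct_smul, normal_dot_left, normal_dot_right, smul_eq_mul]
  ring

lemma Tile.dot_le_upperBase (hij : i ≠ j) (hki : k ≠ i) (hkj : k ≠ j) {τ : Tile}
    (hτ : τ.dirs = {i, j, k}) {y : Fin 3 → ℝ} (hy : y ∈ τ.carrier) :
    normal i j ⬝ᵥ y ≤ normal i j ⬝ᵥ τ.upperBase i j k := by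
  rw [Tile.dot_eq hij hki hkj hτ y, upperBase]
  have := (τ.mem_carrier_iff y).1 hy k
  split_ifs with h
  · rw [dotProduct_add]; nlinarith
  · nlinarith

lemma Tile.exists_upper_corner (hki : k ≠ i) (hkj : k ≠ j) {τ : Tile}
    (hτ : τ.dirs = {i, j, k}) :
    ∃ U ⊆ τ.dirs \ {i, j}, τ.upperBase i j k = τ.corner U := by
  by_cases h : 0 < normal i j ⬝ᵥ v k
  · exact ⟨{k}, by simp [hτ, hki, hkj], by simp [upperBase, h, corner]⟩
  · exact ⟨∅, by simp, by simp [upperBase, h, corner]⟩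

lemma Tile.exists_lower_corner (hki : k ≠ i) (hkj : k ≠ j) {τ : Tile}
    (hτ : τ.dirs = {i, j, k}) :
    ∃ U ⊆ τ.dirs \ {i, j}, τ.lowerBase i j k = τ.corner U := by
  by_cases h : 0 < normal i j ⬝ᵥ v k
  · exact ⟨∅, by simp, by simp [lowerBase, h, corner]⟩
  · exact ⟨{k}, by simp [hτ, hki, hkj], by simp [lowerBase, h, corner]⟩

lemma eq_of_cell_eq {D D' : Finset (Fin 6)} (hD' : D'.card = 3) (hD : D ⊆ D') {p q : Fin 3 → ℝ}
    (h : cell v p D = cell v q D) : p = q := by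
  have key : ∀ p q, cell v p D = cell v q D → ∀ k, 0 ≤ chart D' (q - p) k := by
    intro p q h k
    have hq : q ∈ cell v q D := ⟨0, by simp, by simp⟩
    rw [← h] at hq
    obtain ⟨c, hc, rfl⟩ := hq
    rw [add_sub_cancel_left, chart_sum hD' hD, sum_single_apply]
    split_ifs
    · exact (hc k).1
    · exact le_rfl
  have h0 : q - p = 0 := by
    rw [← sum_univ_chart_smul hD' (q - p)]
    refine Finset.sum_eq_zero fun k _ => ?_
    have h1 := key p q h k
    have h2 := key q p h.symm k
    rw [← neg_sub, map_neg, Pi.neg_apply] at h2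
    rw [le_antisymm (by linarith) h1, zero_smul]
  exact (sub_eq_zero.1 h0).symm

lemma Tile.exists_third (hij : i ≠ j) {τ : Tile} (hi : i ∈ τ.dirs) (hj : j ∈ τ.dirs) :
    ∃ k, k ≠ i ∧ k ≠ j ∧ τ.dirs = {i, j, k} := by
  have h1 : (τ.dirs \ {i, j}).card = 1 := by
    rw [Finset.card_sdiff_of_subset (by simp [Finset.insert_subset_iff, hi, hj]), τ.card_dirs,
      Finset.card_pair hij]
  obtain ⟨k, hk⟩ := Finset.card_eq_one.1 h1
  have hk' : k ∈ τ.dirs \ {i, j} := by simp [hk]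
  simp only [Finset.mem_sdiff, Finset.mem_insert, Finset.mem_singleton, not_or] at hk'
  refine ⟨k, hk'.2.1, hk'.2.2, ?_⟩
  rw [← Finset.sdiff_union_of_subset (show ({i, j} : Finset (Fin 6)) ⊆ τ.dirs by
    simp [Finset.insert_subset_iff, hi, hj]), hk]
  ext x; simp; tauto

lemma subset_third {U D : Finset (Fin 6)} (hD : D = {i, j, k}) (hU : U ⊆ D \ {i, j}) : U ⊆ {k} := by
  intro x hx
  have := hU hx
  simp only [hD, Finset.mem_sdiff, Finset.mem_insert, Finset.mem_singleton] at this ⊢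
  tauto

theorem Tiling.exists_upper_neighbour (T : Tiling) (hij : i ≠ j) (hki : k ≠ i) (hkj : k ≠ j)
    {τ : Tile} (hτ : τ ∈ T.tiles) (hdirs : τ.dirs = {i, j, k}) :
    ∃ σ ∈ T.tiles, ∃ l, l ≠ i ∧ l ≠ j ∧ σ.dirs = {i, j, l} ∧
      σ.lowerBase i j l = τ.upperBase i j k ∧
      τ.carrier ∩ σ.carrier = cell v (τ.upperBase i j k) {i, j} := by
  obtain ⟨U, hU, hq⟩ := Tile.exists_upper_corner hki hkj hdirs
  set q := τ.upperBase i j k with hqdef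
  set m : Fin 3 → ℝ := q + ∑ _a ∈ ({i, j} : Finset (Fin 6)), (1 / 2 : ℝ) • v _a with hm
  have hiD : ({i, j} : Finset (Fin 6)) ⊆ τ.dirs := by
    rw [hdirs]; intro x; simp; tauto
  have hmface : m ∈ cell v (τ.corner U) {i, j} :=
    ⟨fun _ => 1 / 2, fun _ => by norm_num, by rw [hm, hq]⟩
  have hmface' := (τ.mem_face_iff hiD hU m).1 hmface
  have hmτ : m ∈ τ.carrier := by
    rw [τ.mem_carrier_iff]
    intro x
    by_cases hx : x ∈ ({i, j} : Finset (Fin 6))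
    · exact hmface'.1 x hx
    · by_cases hx' : x ∈ τ.dirs
      · rw [hmface'.2 x (Finset.mem_sdiff.2 ⟨hx', hx⟩)]; split_ifs <;> norm_num
      · rw [chart_of_notMem τ.card_dirs hx']; norm_num
  have hhalf : ∀ x ∈ ({i, j} : Finset (Fin 6)), chart τ.dirs (m - τ.pos) x = 1 / 2 := by
    intro x hx
    have hxU : x ∉ U := fun h => (Finset.mem_sdiff.1 (hU h)).2 hx
    rw [hm, hq, add_sub_right_comm, map_add, chart_sum τ.card_dirs hiD (fun _ => 1 / 2),
      τ.chart_corner_sub (hU.trans Finset.sdiff_subset), Pi.add_apply,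
      sum_single_apply _ (fun _ => 1), sum_single_apply _ (fun _ => 1 / 2), if_pos hx, if_neg hxU,
      zero_add]
  obtain ⟨r, hr, hstar⟩ := T.exists_star_radius m
  set N := normal i j with hN
  set t : ℝ := r / (2 * (‖N‖ + 1)) with ht
  have hN0 : 0 ≤ ‖N‖ := norm_nonneg N
  have ht0 : 0 < t := by positivity
  obtain ⟨σ, hσ, hpσ⟩ := T.exists_mem (m + t • N)
  have hmσ : m ∈ σ.carrier := hstar σ hσ ⟨_, hpσ, by
    rw [Metric.mem_ball, dist_eq_norm, add_sub_cancel_left, norm_smul, Real.norm_eq_abs,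
      abs_of_pos ht0, ht, div_mul_eq_mul_div, div_lt_iff₀ (by positivity)]
    nlinarith⟩
  have hmN : N ⬝ᵥ m = N ⬝ᵥ q := by
    rw [hm, Finset.sum_pair hij, dotProduct_add, dotProduct_add, dotProduct_smul, dotProduct_smul,
      hN, normal_dot_left, normal_dot_right]
    simp
  have hNN : 0 < N ⬝ᵥ N := by
    obtain ⟨_, _, _, _, _, _, _, _, h⟩ := exists_pairFrame hij
    rw [hN, h.norm_sq]
    have := Real.goldenRatio_pos
    positivity
  have hpN : N ⬝ᵥ q < N ⬝ᵥ (m + t • N) := by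
    rw [dotProduct_add, dotProduct_smul, hmN, smul_eq_mul]
    have := mul_pos ht0 hNN
    linarith
  have hne : τ ≠ σ := by
    rintro rfl
    exact absurd (Tile.dot_le_upperBase hij hki hkj hdirs hpσ) (not_le.2 hpN)
  obtain ⟨D, hDcard, ⟨hDτ, U₁, hU₁, hF₁⟩, ⟨hDσ, U₂, hU₂, hF₂⟩⟩ :=
    T.face_to_face τ hτ σ hσ hne ⟨m, hmτ, hmσ⟩
  have hmem : m ∈ τ.carrier ∩ σ.carrier := ⟨hmτ, hmσ⟩
  have hmem₁ := hmem
  rw [hF₁, τ.mem_face_iff hDτ hU₁] at hmem₁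
  have hsub : ({i, j} : Finset (Fin 6)) ⊆ D := by
    intro x hx
    by_contra hxD
    have := hmem₁.2 x (Finset.mem_sdiff.2 ⟨hiD hx, hxD⟩)
    rw [hhalf x hx] at this
    split_ifs at this <;> norm_num at this
  obtain rfl : ({i, j} : Finset (Fin 6)) = D :=
    Finset.eq_of_subset_of_card_le hsub (by rw [Finset.card_pair hij]; exact hDcard)
  have hkD : k ∈ τ.dirs \ {i, j} := by simp [hdirs, hki, hkj]
  have hUU : U₁ = U := by
    have e := (hmem₁.2 k hkD).symm.trans (hmface'.2 k hkD)
    have hkk : k ∈ U₁ ↔ k ∈ U := by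
      by_cases h1 : k ∈ U₁ <;> by_cases h2 : k ∈ U <;> simp [h1, h2] at e ⊢
    have s1 := subset_third hdirs hU₁
    have s2 := subset_third hdirs hU
    ext x
    refine ⟨fun hx => ?_, fun hx => ?_⟩
    · obtain rfl := Finset.mem_singleton.1 (s1 hx); exact hkk.1 hx
    · obtain rfl := Finset.mem_singleton.1 (s2 hx); exact hkk.2 hx
  have hinter : τ.carrier ∩ σ.carrier = cell v q {i, j} := by rw [hF₁, hUU, hq]
  obtain ⟨l, hli, hlj, hσdirs⟩ := Tile.exists_third hij (hDσ (by simp)) (hDσ (by simp))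
  have hbase : σ.corner U₂ = q := eq_of_cell_eq σ.card_dirs hDσ (hF₂.symm.trans hinter)
  have hl := (σ.mem_carrier_iff _).1 hpσ l
  rw [Tile.dot_eq hij hli hlj hσdirs (m + t • N)] at hpN
  refine ⟨σ, hσ, l, hli, hlj, hσdirs, ?_, hinter⟩
  rcases Finset.subset_singleton_iff.1 (subset_third hσdirs hU₂) with h | h
  · rw [h, Tile.corner, Finset.sum_empty, add_zero] at hbase
    rw [Tile.lowerBase, if_pos, hbase]
    rw [hbase] at hpN hl
    by_contra hcon
    have := mul_nonpos_of_nonneg_of_nonpos hl.1 (not_lt.1 hcon)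
    linarith
  · rw [h, Tile.corner, Finset.sum_singleton] at hbase
    rw [Tile.lowerBase, if_neg, hbase]
    intro hcon
    rw [← hbase, dotProduct_add] at hpN
    nlinarith [hl.2]

end

lemma exists_int_chain {α : Type*} {R : α → α → Prop} (hup : ∀ a, ∃ b, R a b)
    (hdown : ∀ a, ∃ b, R b a) (a : α) : ∃ s : ℤ → α, s 0 = a ∧ ∀ n, R (s n) (s (n + 1)) := by
  choose u hu using hup
  choose d hd using hdown
  let s : ℤ → α := fun n => match n with
    | Int.ofNat n => u^[n] a
    | Int.negSucc n => d^[n + 1] a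
  refine ⟨s, rfl, fun n => ?_⟩
  match n with
  | Int.ofNat n =>
    have : s (Int.ofNat n + 1) = u (s (Int.ofNat n)) := Function.iterate_succ_apply' u n a
    rw [this]; exact hu _
  | Int.negSucc 0 => exact hd _
  | Int.negSucc (n + 1) =>
    have : s (Int.negSucc (n + 1)) = d (s (Int.negSucc n)) := Function.iterate_succ_apply' d _ a
    rw [this]; exact hd _

lemma Tiling.exists_worm (T : Tiling) {i j : Fin 6} (hij : i ≠ j) {τ : Tile} (hτ : τ ∈ T.tiles)
    (hi : i ∈ τ.dirs) (hj : j ∈ τ.dirs) :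
    ∃ (s : ℤ → Tile) (κ : ℤ → Fin 6), s 0 = τ ∧ T.IsWorm i j s ∧
      ∀ n, κ n ≠ i ∧ κ n ≠ j ∧ (s n).dirs = {i, j, κ n} ∧
        (s (n + 1)).lowerBase i j (κ (n + 1)) = (s n).upperBase i j (κ n) := by
  let α := {p : Tile × Fin 6 // p.1 ∈ T.tiles ∧ p.2 ≠ i ∧ p.2 ≠ j ∧ p.1.dirs = {i, j, p.2}}
  let R : α → α → Prop := fun a b =>
    b.1.1.lowerBase i j b.1.2 = a.1.1.upperBase i j a.1.2 ∧
      a.1.1.carrier ∩ b.1.1.carrier = cell v (a.1.1.upperBase i j a.1.2) {i, j}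
  have hup : ∀ a, ∃ b, R a b := by
    rintro ⟨⟨σ, k⟩, hσ, hki, hkj, hd⟩
    obtain ⟨σ', hσ', l, hli, hlj, hd', h1, h2⟩ := T.exists_upper_neighbour hij hki hkj hσ hd
    exact ⟨⟨⟨σ', l⟩, hσ', hli, hlj, hd'⟩, h1, h2⟩
  have hdown : ∀ a, ∃ b, R b a := by
    rintro ⟨⟨σ, k⟩, hσ, hki, hkj, hd⟩
    have hd₂ : σ.dirs = {j, i, k} := by rw [Finset.insert_comm]; exact hd
    obtain ⟨σ', hσ', l, hlj, hli, hd', h1, h2⟩ :=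
      T.exists_upper_neighbour hij.symm hkj hki hσ hd₂
    rw [Tile.lowerBase_swap hij hli hlj] at h1
    rw [Tile.upperBase_swap hij hki hkj] at h1 h2
    rw [Finset.insert_comm] at hd'
    refine ⟨⟨⟨σ', l⟩, hσ', hli, hlj, hd'⟩, h1.symm, ?_⟩
    show σ'.carrier ∩ σ.carrier = cell v (σ'.upperBase i j l) {i, j}
    rw [Set.inter_comm, h2, Finset.pair_comm, h1]
  obtain ⟨k, hki, hkj, hd⟩ := Tile.exists_third hij hi hj
  obtain ⟨s, hs0, hs⟩ := exists_int_chain hup hdown ⟨⟨τ, k⟩, hτ, hki, hkj, hd⟩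
  have hlt : ∀ n, normal i j ⬝ᵥ (s n).1.1.lowerBase i j (s n).1.2 <
      normal i j ⬝ᵥ (s n).1.1.upperBase i j (s n).1.2 := by
    intro n
    obtain ⟨-, h1, h2, -⟩ := (s n).2
    have := triple_ne_zero hij h1 h2
    rw [Tile.lowerBase, Tile.upperBase]
    split_ifs with h
    · rw [dotProduct_add]; linarith
    · rw [dotProduct_add]
      have := lt_of_le_of_ne (not_lt.1 h) this
      linarith
  refine ⟨fun n => (s n).1.1, fun n => (s n).1.2, by simp only [hs0], ⟨fun n => (s n).2.1, ?_, ?_⟩, ?_⟩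
  · intro n
    obtain ⟨-, h1, h2, h3⟩ := (s n).2
    obtain ⟨-, h1', h2', h3'⟩ := (s (n + 1)).2
    rw [(hs n).2]
    refine ⟨⟨by rw [h3]; intro x; simp; tauto, ?_⟩, ⟨by rw [h3']; intro x; simp; tauto, ?_⟩⟩
    · obtain ⟨U, hU, h⟩ := Tile.exists_upper_corner h1 h2 h3
      exact ⟨U, hU, by rw [h]⟩
    · obtain ⟨U, hU, h⟩ := Tile.exists_lower_corner h1' h2' h3'
      exact ⟨U, hU, by rw [← h, (hs n).1]⟩
  · intro n h
    have h' : (s n).1.1 = (s (n + 1 + 1)).1.1 := by rw [h]; ring_nf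
    have hk : (s n).1.2 = (s (n + 1 + 1)).1.2 := by
      have e1 := (s n).2
      have e2 := (s (n + 1 + 1)).2
      have e3 := e1.2.2.2
      rw [h', e2.2.2.2] at e3
      have : (s n).1.2 ∈ ({i, j, (s (n + 1 + 1)).1.2} : Finset (Fin 6)) := by rw [e3]; simp
      simp only [Finset.mem_insert, Finset.mem_singleton] at this
      exact (this.resolve_left e1.2.1).resolve_left e1.2.2.1
    have l1 := hlt n
    have l2 := hlt (n + 1)
    rw [← (hs n).1, h', hk] at l1
    rw [← (hs (n + 1)).1] at l2
    exact lt_asymm l1 l2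
  · intro n
    exact ⟨(s n).2.2.1, (s n).2.2.2.1, (s n).2.2.2.2, (hs n).1⟩

end Golden

namespace Golden

lemma abs_sub_le_one_of_alternating {u x : ℤ → ℝ} (hu : ∀ n, u (n + 1) = u n + x n)
    (hx : ∀ n, |x n| ≤ 1)
    (halt : ∀ m n, m < n → x m ≠ 0 → x n ≠ 0 → (∀ l, m < l → l < n → x l = 0) → x n = -x m)
    (m n : ℤ) : |u n - u m| ≤ 1 := by
  wlog hmn : m ≤ n generalizing m n
  · rw [abs_sub_comm]; exact this n m (not_le.1 hmn).le
  have key : (u n = u m ∧ ∀ t, m ≤ t → t < n → x t = 0) ∨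
      ∃ t, m ≤ t ∧ t < n ∧ x t ≠ 0 ∧ (∀ t', t < t' → t' < n → x t' = 0) ∧
        (u n = u m ∨ u n = u m + x t) := by
    induction n, hmn using Int.leInduction with
    | base => exact Or.inl ⟨rfl, fun t h1 h2 => absurd h2 (not_lt.2 h1)⟩
    | succ n hn ih =>
      by_cases h0 : x n = 0
      · rw [hu n, h0, add_zero]
        rcases ih with ⟨h1, h2⟩ | ⟨t, h1, h2, h3, h4, h5⟩
        · refine Or.inl ⟨h1, fun t ht1 ht2 => ?_⟩
          rcases (Int.lt_add_one_iff.1 ht2).lt_or_eq with h | rfl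
          exacts [h2 t ht1 h, h0]
        · refine Or.inr ⟨t, h1, h2.trans (lt_add_one n), h3, fun t' ht1 ht2 => ?_, h5⟩
          rcases (Int.lt_add_one_iff.1 ht2).lt_or_eq with h | rfl
          exacts [h4 t' ht1 h, h0]
      · right
        refine ⟨n, hn, lt_add_one n, h0, fun t' h1 h2 => by omega, ?_⟩
        rcases ih with ⟨h1, -⟩ | ⟨t, h1, h2, h3, h4, h5⟩
        · right; rw [hu, h1]
        · have := halt t n h2 h3 h0 h4
          rw [hu, this]
          rcases h5 with h5 | h5 <;> rw [h5]
          · right; rfl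
          · left; ring
  rcases key with ⟨h, -⟩ | ⟨t, -, -, -, -, h | h⟩
  · simp [h]
  · simp [h]
  · rw [h, add_sub_cancel_left]; exact hx t

lemma exists_int_between {g : ℤ → ℝ} {δ : ℝ} (hδ : 0 < δ) (hg : ∀ n, g n + δ ≤ g (n + 1)) (t : ℝ) :
    ∃ n, g n ≤ t ∧ t < g (n + 1) := by
  have hup : ∀ n : ℕ, g 0 + δ * n ≤ g n := by
    intro n
    induction n with
    | zero => simp
    | succ n ih => have := hg n; push_cast; linarith
  have hdown : ∀ n : ℕ, g (-n) ≤ g 0 - δ * n := by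
    intro n
    induction n with
    | zero => simp
    | succ n ih =>
      have := hg (-(n + 1 : ℕ))
      rw [show (-((n + 1 : ℕ) : ℤ)) + 1 = -n by push_cast; ring] at this
      push_cast at this ⊢; linarith
  have hmono : StrictMono g := strictMono_int_of_lt_succ fun n => by have := hg n; linarith
  obtain ⟨N, hN⟩ := exists_nat_gt ((t - g 0) / δ)
  obtain ⟨M, hM⟩ := exists_nat_gt ((g 0 - t) / δ)
  rw [div_lt_iff₀ hδ] at hN hM
  obtain ⟨n, hn, hmax⟩ := Int.exists_greatest_of_bdd (P := fun n => g n ≤ t)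
    ⟨N, fun z hz => by
      by_contra hcon
      have := hmono (not_le.1 hcon)
      have := hup N
      linarith⟩ ⟨-M, by have := hdown M; linarith⟩
  refine ⟨n, hn, ?_⟩
  by_contra hcon
  have := hmax (n + 1) (not_lt.1 hcon)
  omega

lemma norm_v_le (k : Fin 6) : ‖v k‖ ≤ 2 := by
  obtain ⟨φ, hφ⟩ : ∃ φ, φ = Real.goldenRatio := ⟨_, rfl⟩
  have h3 : |φ| ≤ 2 := by
    rw [hφ, abs_of_pos Real.goldenRatio_pos]; exact Real.goldenRatio_lt_two.le
  refine (pi_norm_le_iff_of_nonneg (by norm_num)).2 fun t => ?_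
  fin_cases k <;> fin_cases t <;> simp only [v, ← hφ] <;> simp <;> exact h3

lemma abs_dotProduct_le (x y : Fin 3 → ℝ) : |x ⬝ᵥ y| ≤ 3 * ‖x‖ * ‖y‖ := by
  rw [dotProduct, Fin.sum_univ_three]
  have h : ∀ t, |x t * y t| ≤ ‖x‖ * ‖y‖ := fun t => by
    rw [abs_mul]
    exact mul_le_mul (norm_le_pi_norm x t) (norm_le_pi_norm y t) (abs_nonneg _) (norm_nonneg _)
  have h0 := h 0
  have h1 := h 1
  have h2 := h 2
  rw [abs_le] at *
  constructor <;> linarith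

lemma norm_smul_sign_le {a : ℝ} (ha : a = 1 ∨ a = -1) (k : Fin 6) : ‖a • v k‖ ≤ 2 := by
  have : |a| = 1 := by rcases ha with rfl | rfl <;> simp
  rw [norm_smul, Real.norm_eq_abs, this, one_mul]
  exact norm_v_le k

section

variable {i j k l m n : Fin 6} {a b c d : ℝ}

lemma PairFrame.norm_normal_le (h : PairFrame i j k l m n a b c d) : ‖normal i j‖ ≤ 4 := by
  rw [← h.fat_sum]
  have h1 := norm_smul_sign_le h.sign_c m
  have h2 := norm_smul_sign_le h.sign_d n
  linarith [norm_add_le (c • v m) (d • v n)]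

lemma PairFrame.abs_dot_bounds (h : PairFrame i j k l m n a b c d) {x : Fin 6} (hxi : x ≠ i)
    (hxj : x ≠ j) : 1 ≤ |normal i j ⬝ᵥ v x| ∧ |normal i j ⬝ᵥ v x| ≤ 8 := by
  have h1 := Real.one_lt_goldenRatio
  have h2 := Real.goldenRatio_lt_two
  have e : ∀ y : ℝ, y = 1 ∨ y = -1 → |y| = 1 := by rintro y (rfl | rfl) <;> simp
  have e1 : |2 * Real.goldenRatio| = 2 * Real.goldenRatio := abs_of_pos (by positivity)
  have e2 : |2 * Real.goldenRatio ^ 2| = 2 * Real.goldenRatio ^ 2 := abs_of_pos (by positivity)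
  rcases h.forall_mem x with rfl | rfl | rfl | rfl | rfl | rfl
  · exact absurd rfl hxi
  · exact absurd rfl hxj
  · rw [h.dot_k, abs_mul, e _ h.sign_a, e1]; constructor <;> linarith
  · rw [h.dot_l, abs_mul, e _ h.sign_b, e1]; constructor <;> linarith
  · rw [h.dot_m, abs_mul, e _ h.sign_c, e2]; constructor <;> nlinarith
  · rw [h.dot_n, abs_mul, e _ h.sign_d, e2]; constructor <;> nlinarith

/-- If the components of `w` along the thin directions almost agree, as well as those along the fat
directions, then `w` is close to the line spanned by the normal vector. -/
lemma PairFrame.norm_sub_smul_normal_le (h : PairFrame i j k l m n a b c d) {δ : Fin 6 → ℝ}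
    {w : Fin 3 → ℝ} (hw : ∑ x, δ x • v x = w) (hi : δ i = 0) (hj : δ j = 0)
    (hthin : |a * δ k - b * δ l| ≤ 1) (hfat : |c * δ m - d * δ n| ≤ 1) :
    ‖w - (normal i j ⬝ᵥ w / (4 * Real.goldenRatio ^ 2)) • normal i j‖ ≤ 52 := by
  set N := normal i j with hN
  set φ := Real.goldenRatio with hφ
  set γ := (φ - 1) * (a * δ k) + c * δ m with hγ
  set err := (a * δ k - b * δ l) • (b • v l) + (c * δ m - d * δ n) • (d • v n) with herr
  have sq : ∀ y : ℝ, y = 1 ∨ y = -1 → y * y = 1 := by rintro y (rfl | rfl) <;> simp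
  have hwe : w = γ • N - err := by
    have eγ : γ • N = (a * δ k) • (a • v k + b • v l) + (c * δ m) • (c • v m + d • v n) := by
      rw [h.thin_sum, h.fat_sum, hγ]; module
    rw [← hw, h.sum_univ, hi, hj, eγ, herr]
    have e1 := sq a h.sign_a
    have e2 := sq b h.sign_b
    have e3 := sq c h.sign_c
    have e4 := sq d h.sign_d
    have k1 : δ k • v k = (a * a * δ k) • v k := by rw [e1, one_mul]
    have k2 : δ l • v l = (b * b * δ l) • v l := by rw [e2, one_mul]
    have k3 : δ m • v m = (c * c * δ m) • v m := by rw [e3, one_mul]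
    have k4 : δ n • v n = (d * d * δ n) • v n := by rw [e4, one_mul]
    rw [k1, k2, k3, k4]
    module
  have hφ1 : 1 < φ := Real.one_lt_goldenRatio
  have hφ4 : 4 ≤ 4 * φ ^ 2 := by nlinarith
  have hNn : ‖N‖ ≤ 4 := h.norm_normal_le
  have herrn : ‖err‖ ≤ 4 := by
    have h1 := norm_smul_sign_le h.sign_b l
    have h2 := norm_smul_sign_le h.sign_d n
    refine (norm_add_le _ _).trans ?_
    rw [norm_smul, norm_smul (c * δ m - d * δ n), Real.norm_eq_abs, Real.norm_eq_abs]
    nlinarith [norm_nonneg (b • v l), norm_nonneg (d • v n), abs_nonneg (a * δ k - b * δ l),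
      abs_nonneg (c * δ m - d * δ n)]
  have hdot : N ⬝ᵥ w = γ * (4 * φ ^ 2) - N ⬝ᵥ err := by
    rw [hwe, dotProduct_sub, dotProduct_smul, smul_eq_mul, h.norm_sq]
  have hdiv : N ⬝ᵥ w / (4 * φ ^ 2) = γ - N ⬝ᵥ err / (4 * φ ^ 2) := by
    rw [hdot]; field_simp
  have hb : |N ⬝ᵥ err / (4 * φ ^ 2)| ≤ 12 := by
    rw [abs_div, abs_of_pos (by positivity : 0 < 4 * φ ^ 2), div_le_iff₀ (by positivity)]
    have h1 := abs_dotProduct_le N err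
    have h2 : ‖N‖ * ‖err‖ ≤ 4 * 4 := mul_le_mul hNn herrn (norm_nonneg _) (by norm_num)
    nlinarith
  have hfin : w - (N ⬝ᵥ w / (4 * φ ^ 2)) • N = (N ⬝ᵥ err / (4 * φ ^ 2)) • N - err := by
    rw [hdiv, hwe]; module
  rw [hfin]
  refine (norm_sub_le _ _).trans ?_
  rw [norm_smul, Real.norm_eq_abs]
  have : |N ⬝ᵥ err / (4 * φ ^ 2)| * ‖N‖ ≤ 12 * 4 :=
    mul_le_mul hb hNn (norm_nonneg _) (by norm_num)
  linarith

/-- The sign of the scalar product of `v k` with the normal vector of `v i` and `v j`. -/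
noncomputable def tripleSign (i j k : Fin 6) : ℝ := if 0 < normal i j ⬝ᵥ v k then 1 else -1

lemma tripleSign_eq {x y : ℝ} (hy : 0 < y) (hx : x = 1 ∨ x = -1)
    (h : normal i j ⬝ᵥ v k = y * x) : tripleSign i j k = x := by
  rw [tripleSign, h]
  rcases hx with rfl | rfl
  · rw [if_pos (by linarith)]
  · rw [if_neg (by linarith)]

lemma PairFrame.tripleSign_k (h : PairFrame i j k l m n a b c d) : tripleSign i j k = a :=
  tripleSign_eq (by have := Real.goldenRatio_pos; positivity) h.sign_a h.dot_k

lemma PairFrame.tripleSign_l (h : PairFrame i j k l m n a b c d) : tripleSign i j l = b :=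
  tripleSign_eq (by have := Real.goldenRatio_pos; positivity) h.sign_b h.dot_l

lemma PairFrame.tripleSign_m (h : PairFrame i j k l m n a b c d) : tripleSign i j m = c :=
  tripleSign_eq (by have := Real.goldenRatio_pos; positivity) h.sign_c h.dot_m

lemma PairFrame.tripleSign_n (h : PairFrame i j k l m n a b c d) : tripleSign i j n = d :=
  tripleSign_eq (by have := Real.goldenRatio_pos; positivity) h.sign_d h.dot_n

lemma tripleSign_mul_self (i j k : Fin 6) : tripleSign i j k * tripleSign i j k = 1 := by
  rw [tripleSign]; split_ifs <;> norm_num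

lemma tripleSign_mul_dot (i j k : Fin 6) :
    tripleSign i j k * (normal i j ⬝ᵥ v k) = |normal i j ⬝ᵥ v k| := by
  rw [tripleSign]
  split_ifs with h
  · rw [abs_of_pos h, one_mul]
  · rw [abs_of_nonpos (not_lt.1 h), neg_one_mul]

lemma Tile.upperBase_eq (i j k : Fin 6) (τ : Tile) :
    τ.upperBase i j k = τ.lowerBase i j k + tripleSign i j k • v k := by
  rw [upperBase, lowerBase, tripleSign]
  split_ifs <;> simp

lemma Tile.lowerBase_mem (hki : k ≠ i) (hkj : k ≠ j) {τ : Tile} (hτ : τ.dirs = {i, j, k}) :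
    τ.lowerBase i j k ∈ τ.carrier := by
  obtain ⟨U, hU, h⟩ := Tile.exists_lower_corner hki hkj hτ
  rw [h]; exact τ.corner_mem_carrier (hU.trans Finset.sdiff_subset)

lemma Tile.upperBase_mem (hki : k ≠ i) (hkj : k ≠ j) {τ : Tile} (hτ : τ.dirs = {i, j, k}) :
    τ.upperBase i j k ∈ τ.carrier := by
  obtain ⟨U, hU, h⟩ := Tile.exists_upper_corner hki hkj hτ
  rw [h]; exact τ.corner_mem_carrier (hU.trans Finset.sdiff_subset)

lemma Tile.norm_lowerBase_sub_pos_le (i j k : Fin 6) (τ : Tile) :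
    ‖τ.lowerBase i j k - τ.pos‖ ≤ 2 := by
  rw [lowerBase]
  split_ifs
  · simp
  · rw [add_sub_cancel_left]; exact norm_v_le k

end

/-- The directions `k` and `l` are those of the two tiles of one type in an `ij`-worm. -/
structure SameTypePair (i j k l : Fin 6) : Prop where
  ne : k ≠ l
  thin_iff : ({i, j, k} : Finset (Fin 6)) ∈ thinTriples ↔ ({i, j, l} : Finset (Fin 6)) ∈ thinTriples
  eq_or_eq : ∀ x, x ≠ i → x ≠ j → (({i, j, x} : Finset (Fin 6)) ∈ thinTriples ↔
    ({i, j, k} : Finset (Fin 6)) ∈ thinTriples) → x = k ∨ x = l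

section

variable {i j k l m n : Fin 6} {a b c d : ℝ}

lemma PairFrame.sameTypePair_thin (h : PairFrame i j k l m n a b c d) : SameTypePair i j k l where
  ne := by have := h.nodup; simp at this; tauto
  thin_iff := iff_of_true h.thin_k h.thin_l
  eq_or_eq x hxi hxj hx := by
    have hx' := hx.2 h.thin_k
    rcases h.forall_mem x with rfl | rfl | rfl | rfl | rfl | rfl
    exacts [absurd rfl hxi, absurd rfl hxj, Or.inl rfl, Or.inr rfl, absurd hx' h.fat_m,
      absurd hx' h.fat_n]

lemma PairFrame.sameTypePair_fat (h : PairFrame i j k l m n a b c d) : SameTypePair i j m n where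
  ne := by have := h.nodup; simp at this; tauto
  thin_iff := iff_of_false h.fat_m h.fat_n
  eq_or_eq x hxi hxj hx := by
    have hx' := mt hx.1 h.fat_m
    rcases h.forall_mem x with rfl | rfl | rfl | rfl | rfl | rfl
    exacts [absurd rfl hxi, absurd rfl hxj, absurd h.thin_k hx', absurd h.thin_l hx', Or.inl rfl,
      Or.inr rfl]

/-- A worm, together with the third directions of its tiles, going upwards along the normal. -/
structure Tiling.WormData (T : Tiling) (i j : Fin 6) (s : ℤ → Tile) (κ : ℤ → Fin 6) : Prop where
  isWorm : T.IsWorm i j s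
  ne_i : ∀ n, κ n ≠ i
  ne_j : ∀ n, κ n ≠ j
  dirs_eq : ∀ n, (s n).dirs = {i, j, κ n}
  lowerBase_succ : ∀ n,
    (s (n + 1)).lowerBase i j (κ (n + 1)) = (s n).upperBase i j (κ n)

lemma Tiling.exists_wormData (T : Tiling) (hij : i ≠ j) {τ : Tile} (hτ : τ ∈ T.tiles)
    (hi : i ∈ τ.dirs) (hj : j ∈ τ.dirs) :
    ∃ (s : ℤ → Tile) (κ : ℤ → Fin 6), s 0 = τ ∧ T.WormData i j s κ := by
  obtain ⟨s, κ, h0, hw, h⟩ := T.exists_worm hij hτ hi hj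
  exact ⟨s, κ, h0, hw, fun n => (h n).1, fun n => (h n).2.1, fun n => (h n).2.2.1,
    fun n => (h n).2.2.2⟩

variable {T : Tiling} {s : ℤ → Tile} {κ : ℤ → Fin 6} {f : (Fin 3 → ℝ) → (Fin 6 → ℝ)}

lemma Tiling.WormData.unfolding_succ (hw : T.WormData i j s κ) (hf : T.IsUnfolding f) (t : ℤ) :
    f ((s (t + 1)).lowerBase i j (κ (t + 1))) =
      f ((s t).lowerBase i j (κ t)) + Pi.single (κ t) (tripleSign i j (κ t)) := by
  have h := hf (s t) (hw.isWorm.mem t) _ (Tile.lowerBase_mem (hw.ne_i t) (hw.ne_j t) (hw.dirs_eq t))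
    _ (Tile.upperBase_mem (hw.ne_i t) (hw.ne_j t) (hw.dirs_eq t))
  rw [hw.lowerBase_succ, ← sub_eq_iff_eq_add', h, Tile.upperBase_eq, add_sub_cancel_left, map_smul,
    chart_v (s t).card_dirs (by rw [hw.dirs_eq]; simp), ← Pi.single_smul, smul_eq_mul, mul_one]

lemma Tiling.WormData.unfolding_eq (hw : T.WormData i j s κ) (hf : T.IsUnfolding f) {x : Fin 6}
    {p q : ℤ} (hpq : p ≤ q) (hx : ∀ t, p ≤ t → t < q → κ t ≠ x) :
    f ((s q).lowerBase i j (κ q)) x = f ((s p).lowerBase i j (κ p)) x := by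
  induction q, hpq using Int.leInduction with
  | base => rfl
  | succ q hq ih =>
    rw [hw.unfolding_succ hf, Pi.add_apply, Pi.single_eq_of_ne (hx q hq (lt_add_one q)).symm,
      add_zero, ih fun t h1 h2 => hx t h1 (h2.trans (lt_add_one q))]

lemma Tiling.WormData.abs_sub_le_one (hw : T.WormData i j s κ) (hf : T.IsUnfolding f)
    (hT : T.HasAlternation) (hij : i ≠ j) (hkl : SameTypePair i j k l) (p q : ℤ) :
    |tripleSign i j k * (f ((s q).lowerBase i j (κ q)) k - f ((s p).lowerBase i j (κ p)) k) -
      tripleSign i j l * (f ((s q).lowerBase i j (κ q)) l - f ((s p).lowerBase i j (κ p)) l)|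
      ≤ 1 := by
  let u : ℤ → ℝ := fun t => tripleSign i j k * f ((s t).lowerBase i j (κ t)) k -
    tripleSign i j l * f ((s t).lowerBase i j (κ t)) l
  let x : ℤ → ℝ := fun t => if κ t = k then 1 else if κ t = l then -1 else 0
  have hu : ∀ t, u (t + 1) = u t + x t := by
    intro t
    simp only [u, x, hw.unfolding_succ hf, Pi.add_apply, Pi.single_apply]
    by_cases h1 : κ t = k
    · have h2 : l ≠ k := hkl.ne.symm
      simp only [h1, h2, if_true, if_false, mul_add, tripleSign_mul_self]; ring
    · by_cases h2 : κ t = l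
      · simp only [h2, hkl.ne, hkl.ne.symm, if_true, if_false, mul_add, tripleSign_mul_self]; ring
      · simp only [h1, h2, Ne.symm h1, Ne.symm h2, if_false]; ring
  have hx : ∀ t, |x t| ≤ 1 := by
    intro t
    simp only [x]
    split_ifs <;> simp
  have hx0 : ∀ t, x t ≠ 0 ↔ κ t = k ∨ κ t = l := by
    intro t
    simp only [x]
    split_ifs with h1 h2
    · simp [h1]
    · simp [h2]
    · simp [h1, h2]
  have hthin : ∀ t, x t ≠ 0 → ((s t).IsThin ↔ ({i, j, k} : Finset (Fin 6)) ∈ thinTriples) := by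
    intro t ht
    rw [Tile.IsThin, hw.dirs_eq]
    rcases (hx0 t).1 ht with h | h <;> rw [h]
    exact hkl.thin_iff.symm
  have halt : ∀ m n, m < n → x m ≠ 0 → x n ≠ 0 → (∀ l, m < l → l < n → x l = 0) →
      x n = -x m := by
    intro m n hmn hm hn hbet
    have hne := hT i j hij s hw.isWorm m n hmn ((hthin m hm).trans (hthin n hn).symm) (by
      intro t h1 h2 hcon
      have h3 : ¬ (κ t = k ∨ κ t = l) := by
        rw [← hx0 t, not_not]; exact hbet t h1 h2
      have h4 := hcon.trans (hthin m hm)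
      rw [Tile.IsThin, hw.dirs_eq] at h4
      exact h3 (hkl.eq_or_eq _ (hw.ne_i t) (hw.ne_j t) h4))
    have hκ : κ m ≠ κ n := fun h => hne (by rw [hw.dirs_eq, hw.dirs_eq, h])
    have hlk : l ≠ k := hkl.ne.symm
    rcases (hx0 m).1 hm with h1 | h1 <;> rcases (hx0 n).1 hn with h2 | h2
    · exact absurd (h1.trans h2.symm) hκ
    · simp [x, h1, h2, hlk]
    · simp [x, h1, h2, hlk]
    · exact absurd (h1.trans h2.symm) hκ
  have := abs_sub_le_one_of_alternating hu hx halt p q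
  simp only [u] at this
  convert this using 2
  ring

end

end Golden

namespace Golden

variable {i j k l m n : Fin 6} {a b c d : ℝ}

/-- The relations, up to an error `C`, between the increments of the components of `f` from `y` to
`y + s • normal i j` which are due to an `ij`-worm. -/
structure WormRelations (f : (Fin 3 → ℝ) → (Fin 6 → ℝ)) (i j k l m n : Fin 6) (a b c d : ℝ)
    (C : ℝ) (y : Fin 3 → ℝ) (s : ℝ) : Prop where
  left : |f (y + s • normal i j) i - f y i| ≤ C
  right : |f (y + s • normal i j) j - f y j| ≤ C
  thin : |a * (f (y + s • normal i j) k - f y k) - b * (f (y + s • normal i j) l - f y l)| ≤ C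
  fat : |c * (f (y + s • normal i j) m - f y m) - d * (f (y + s • normal i j) n - f y n)| ≤ C

lemma PairFrame.ne (h : PairFrame i j k l m n a b c d) :
    i ≠ j ∧ (k ≠ i ∧ k ≠ j) ∧ (l ≠ i ∧ l ≠ j) ∧ (m ≠ i ∧ m ≠ j) ∧ n ≠ i ∧ n ≠ j := by
  have := h.nodup
  simp only [List.nodup_cons, List.mem_cons, List.not_mem_nil, or_false, not_or] at this
  obtain ⟨⟨h1, h2, h3, h4, h5⟩, ⟨h6, h7, h8, h9⟩, -⟩ := this
  exact ⟨h1, ⟨Ne.symm h2, Ne.symm h6⟩, ⟨Ne.symm h3, Ne.symm h7⟩, ⟨Ne.symm h4, Ne.symm h8⟩, Ne.symm h5,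
    Ne.symm h9⟩

lemma abs_mul_sub_mul_le {a b x y x' y' E F : ℝ} (ha : a = 1 ∨ a = -1) (hb : b = 1 ∨ b = -1)
    (h : |a * x - b * y| ≤ F) (hx : |x' - x| ≤ E) (hy : |y' - y| ≤ E) :
    |a * x' - b * y'| ≤ F + 2 * E := by
  rw [abs_le] at *
  rcases ha with rfl | rfl <;> rcases hb with rfl | rfl <;> constructor <;> linarith

theorem Tiling.exists_wormRelations {T : Tiling} (hT : T.HasAlternation)
    {f : (Fin 3 → ℝ) → (Fin 6 → ℝ)} (hf : T.IsUnfolding f) :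
    ∃ C > 0, ∀ {i j k l m n a b c d}, PairFrame i j k l m n a b c d →
      ∀ τ ∈ T.tiles, i ∈ τ.dirs → j ∈ τ.dirs → ∀ (y : Fin 3 → ℝ) (s ρ : ℝ), ‖y - τ.pos‖ ≤ ρ →
        WormRelations f i j k l m n a b c d (C * (1 + ρ)) y s ∧
        ∀ x, x ≠ i → x ≠ j →
          (∀ σ ∈ T.tiles, σ.dirs = {i, j, x} → C * (1 + |s|) < ‖σ.pos - τ.pos‖) →
          |f (y + s • normal i j) x - f y x| ≤ C * (1 + ρ) := by
  obtain ⟨K, hK, hlip⟩ := hf.exists_lipschitz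
  refine ⟨128 * K + 64, by positivity, ?_⟩
  intro i j k l m n a b c d h τ hτ hi hj y s ρ hρ
  have hρ0 : 0 ≤ ρ := (norm_nonneg _).trans hρ
  have hij := h.ne.1
  obtain ⟨w, κ, hw0, hw⟩ := T.exists_wormData hij hτ hi hj
  set N := normal i j with hN
  set φ := Real.goldenRatio with hφ
  have hφ1 : 1 < φ := Real.one_lt_goldenRatio
  have hφ4 : 4 ≤ 4 * φ ^ 2 := by nlinarith
  have hNn : ‖N‖ ≤ 4 := h.norm_normal_le
  set q : ℤ → Fin 3 → ℝ := fun t => (w t).lowerBase i j (κ t) with hq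
  have hqsucc : ∀ t, q (t + 1) = q t + tripleSign i j (κ t) • v (κ t) := fun t => by
    simp only [hq]
    rw [hw.lowerBase_succ, Tile.upperBase_eq]
  have hg : ∀ t, N ⬝ᵥ q (t + 1) = N ⬝ᵥ q t + |N ⬝ᵥ v (κ t)| := fun t => by
    rw [hqsucc, dotProduct_add, dotProduct_smul, smul_eq_mul, tripleSign_mul_dot]
  have hgb : ∀ t, 1 ≤ |N ⬝ᵥ v (κ t)| ∧ |N ⬝ᵥ v (κ t)| ≤ 8 := fun t =>
    h.abs_dot_bounds (hw.ne_i t) (hw.ne_j t)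
  have hmono : StrictMono fun t => N ⬝ᵥ q t :=
    strictMono_int_of_lt_succ fun t => by
      have := hg t; have := (hgb t).1; linarith
  obtain ⟨r, hr1, hr2⟩ := exists_int_between (g := fun t => N ⬝ᵥ q t) one_pos
    (fun t => by have := hg t; have := (hgb t).1; linarith) (N ⬝ᵥ q 0 + s * (4 * φ ^ 2))
  have hthin : ∀ t, |a * (f (q t) k - f (q 0) k) - b * (f (q t) l - f (q 0) l)| ≤ 1 := fun t => by
    have := hw.abs_sub_le_one hf hT hij h.sameTypePair_thin 0 t
    rwa [h.tripleSign_k, h.tripleSign_l] at this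
  have hfat : ∀ t, |c * (f (q t) m - f (q 0) m) - d * (f (q t) n - f (q 0) n)| ≤ 1 := fun t => by
    have := hw.abs_sub_le_one hf hT hij h.sameTypePair_fat 0 t
    rwa [h.tripleSign_m, h.tripleSign_n] at this
  have hconst : ∀ x t, (∀ u, (0 ≤ u ∧ u < t ∨ t ≤ u ∧ u < 0) → κ u ≠ x) →
      f (q t) x = f (q 0) x := by
    intro x t hx
    rcases le_total 0 t with h0 | h0
    · exact hw.unfolding_eq hf h0 fun u h1 h2 => hx u (Or.inl ⟨h1, h2⟩)
    · exact (hw.unfolding_eq hf h0 fun u h1 h2 => hx u (Or.inr ⟨h1, h2⟩)).symm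
  have hline : ∀ t, ‖q t - q 0 - (N ⬝ᵥ (q t - q 0) / (4 * φ ^ 2)) • N‖ ≤ 52 := fun t =>
    h.norm_sub_smul_normal_le (δ := fun x => f (q t) x - f (q 0) x) (hf.sum_smul (q 0) (q t))
      (sub_eq_zero.2 (hconst i t fun u _ => hw.ne_i u))
      (sub_eq_zero.2 (hconst j t fun u _ => hw.ne_j u)) (hthin t) (hfat t)
  have hq0 : ‖q 0 - τ.pos‖ ≤ 2 := by
    rw [← hw0]; exact Tile.norm_lowerBase_sub_pos_le _ _ _ _
  have hrs : |N ⬝ᵥ (q r - q 0) / (4 * φ ^ 2) - s| ≤ 2 := by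
    have h8 := (hgb r).2
    have := hg r
    rw [dotProduct_sub, div_sub' (by positivity), abs_div, abs_of_pos (by positivity : 0 < 4 * φ ^ 2),
      div_le_iff₀ (by positivity), abs_le]
    constructor <;> nlinarith
  have hz : ‖q r - (y + s • N)‖ ≤ 62 + ρ := by
    have e : q r - (y + s • N) = (q r - q 0 - (N ⬝ᵥ (q r - q 0) / (4 * φ ^ 2)) • N) +
        (N ⬝ᵥ (q r - q 0) / (4 * φ ^ 2) - s) • N + ((q 0 - τ.pos) - (y - τ.pos)) := by module
    have h1 : ‖(N ⬝ᵥ (q r - q 0) / (4 * φ ^ 2) - s) • N‖ ≤ 2 * 4 := by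
      rw [norm_smul]
      exact mul_le_mul hrs hNn (norm_nonneg _) (by norm_num)
    rw [e]
    have h2 := norm_sub_le (q 0 - τ.pos) (y - τ.pos)
    have h3 := hline r
    refine (norm_add₃_le).trans ?_
    linarith
  have hy : ‖q 0 - y‖ ≤ 2 + ρ := by
    have := norm_sub_le (q 0 - τ.pos) (y - τ.pos)
    rw [sub_sub_sub_cancel_right] at this
    linarith
  have hδ : ∀ x, |(f (y + s • N) x - f y x) - (f (q r) x - f (q 0) x)| ≤ 64 * K * (1 + ρ) := by
    intro x
    have h1 := (norm_le_pi_norm (f (q r) - f (y + s • N)) x).trans (hlip _ _)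
    have h2 := (norm_le_pi_norm (f (q 0) - f y) x).trans (hlip _ _)
    have h3 := mul_le_mul_of_nonneg_left hz hK.le
    have h4 := mul_le_mul_of_nonneg_left hy hK.le
    rw [Real.norm_eq_abs, Pi.sub_apply, abs_le] at h1 h2
    rw [abs_le]
    constructor <;> nlinarith
  have h64 : 0 ≤ 64 * K * (1 + ρ) := by positivity
  have hle : 1 + 2 * (64 * K * (1 + ρ)) ≤ (128 * K + 64) * (1 + ρ) := by nlinarith
  have hzero : ∀ x, f (q r) x = f (q 0) x →
      |f (y + s • N) x - f y x| ≤ (128 * K + 64) * (1 + ρ) := by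
    intro x hx
    have := hδ x
    rw [hx, sub_self, sub_zero] at this
    linarith
  refine ⟨⟨hzero i (hconst i r fun u _ => hw.ne_i u), hzero j (hconst j r fun u _ => hw.ne_j u),
    (abs_mul_sub_mul_le h.sign_a h.sign_b (hthin r) (hδ k) (hδ l)).trans hle,
    (abs_mul_sub_mul_le h.sign_c h.sign_d (hfat r) (hδ m) (hδ n)).trans hle⟩, ?_⟩
  intro x hxi hxj hfar
  refine hzero x (hconst x r fun u hu hκ => ?_)
  have hfar' := hfar (w u) (hw.isWorm.mem u) (by rw [hw.dirs_eq, hκ])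
  have hu1 : |N ⬝ᵥ (q u - q 0) / (4 * φ ^ 2)| ≤ |s| + 2 := by
    have h1 : |N ⬝ᵥ (q u - q 0)| ≤ |N ⬝ᵥ (q r - q 0)| := by
      rw [dotProduct_sub, dotProduct_sub]
      rcases hu with ⟨h1, h2⟩ | ⟨h1, h2⟩
      · have m1 := hmono.monotone h1
        have m2 := hmono.monotone h2.le
        rw [abs_of_nonneg (by linarith), abs_of_nonneg (by linarith)]
        linarith
      · have m1 := hmono.monotone h1
        have m2 := hmono.monotone h2.le
        rw [abs_of_nonpos (by linarith), abs_of_nonpos (by linarith)]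
        linarith
    have h2 : |N ⬝ᵥ (q u - q 0) / (4 * φ ^ 2)| ≤ |N ⬝ᵥ (q r - q 0) / (4 * φ ^ 2)| := by
      rw [abs_div, abs_div]; gcongr
    have h3 := abs_sub_abs_le_abs_sub (N ⬝ᵥ (q r - q 0) / (4 * φ ^ 2)) s
    linarith
  have hu2 : ‖(N ⬝ᵥ (q u - q 0) / (4 * φ ^ 2)) • N‖ ≤ (|s| + 2) * 4 := by
    rw [norm_smul]
    exact mul_le_mul hu1 hNn (norm_nonneg _) (by positivity)
  have e : (w u).pos - τ.pos = (q u - q 0 - (N ⬝ᵥ (q u - q 0) / (4 * φ ^ 2)) • N) +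
      (N ⬝ᵥ (q u - q 0) / (4 * φ ^ 2)) • N + ((q 0 - τ.pos) - (q u - (w u).pos)) := by module
  have h1 : ‖q u - (w u).pos‖ ≤ 2 := Tile.norm_lowerBase_sub_pos_le _ _ _ _
  have h2 := norm_sub_le (q 0 - τ.pos) (q u - (w u).pos)
  have h3 := hline u
  have h4 : ‖(w u).pos - τ.pos‖ ≤ 64 + 4 * |s| := by
    rw [e]
    refine (norm_add₃_le).trans ?_
    linarith
  have h5 : 64 + 4 * |s| ≤ (128 * K + 64) * (1 + |s|) := by
    have := abs_nonneg s
    nlinarith [mul_nonneg hK.le this]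
  linarith

end Golden

namespace Golden

variable {i j k l m n : Fin 6} {a b c d : ℝ}

/-- The common slope of the components of an unfolding. -/
noncomputable def slope : ℝ := 1 / (2 + 2 * Real.goldenRatio ^ 2)

lemma PairFrame.swap_fat (h : PairFrame i j k l m n a b c d) : PairFrame i j k l n m a b d c where
  nodup := by
    have := h.nodup
    refine (List.Perm.nodup_iff ?_).1 this
    exact (List.Perm.swap n m []).cons l |>.cons k |>.cons j |>.cons i
  thin_k := h.thin_k
  thin_l := h.thin_l
  fat_m := h.fat_n
  fat_n := h.fat_m
  sign_a := h.sign_a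
  sign_b := h.sign_b
  sign_c := h.sign_d
  sign_d := h.sign_c
  dot_k := h.dot_k
  dot_l := h.dot_l
  dot_m := h.dot_n
  dot_n := h.dot_m
  thin_sum := h.thin_sum
  fat_sum := by rw [add_comm]; exact h.fat_sum
  norm_sq := h.norm_sq

lemma exists_pairFrame_fat {i j m : Fin 6} (hij : i ≠ j) (hmi : m ≠ i) (hmj : m ≠ j)
    (hm : ({i, j, m} : Finset (Fin 6)) ∉ thinTriples) :
    ∃ k l n a b c d, PairFrame i j k l m n a b c d := by
  obtain ⟨k, l, m', n, a, b, c, d, h⟩ := exists_pairFrame hij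
  rcases h.forall_mem m with rfl | rfl | rfl | rfl | rfl | rfl
  · exact absurd rfl hmi
  · exact absurd rfl hmj
  · exact absurd h.thin_k hm
  · exact absurd h.thin_l hm
  · exact ⟨k, l, n, a, b, c, d, h⟩
  · exact ⟨k, l, m', a, b, d, c, h.swap_fat⟩

lemma WormRelations.swap_fat {f : (Fin 3 → ℝ) → (Fin 6 → ℝ)} {C : ℝ} {y : Fin 3 → ℝ} {s : ℝ}
    (h : WormRelations f i j k l m n a b c d C y s) : WormRelations f i j k l n m a b d c C y s where
  left := h.left
  right := h.right
  thin := h.thin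
  fat := by rw [abs_sub_comm]; exact h.fat

/-- In the direction normal to `v i` and `v j`, the deviation from linearity of a fat component is
smaller, by the factor `φ`, than that of a thin component. -/
lemma PairFrame.abs_deviation_le (h : PairFrame i j k l m n a b c d)
    {F : (Fin 3 → ℝ) → (Fin 6 → ℝ)} {C : ℝ} {y : Fin 3 → ℝ} {s : ℝ}
    (hproj : ∀ x y, ∑ k, (F y k - F x k) • v k = y - x)
    (hrel : WormRelations F i j k l m n a b c d C y s) :
    |F (y + s • normal i j) m - F y m - slope * ((s • normal i j) ⬝ᵥ v m)| ≤
      (Real.goldenRatio - 1) *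
        |F (y + s • normal i j) k - F y k - slope * ((s • normal i j) ⬝ᵥ v k)| + C := by
  have hp := congrArg (fun w => normal i j ⬝ᵥ w) (hproj y (y + s • normal i j))
  have ht := hrel.thin
  have hf := hrel.fat
  simp only [add_sub_cancel_left, h.sum_univ, dotProduct_add, dotProduct_smul, smul_eq_mul,
    normal_dot_left, normal_dot_right, h.dot_k, h.dot_l, h.dot_m, h.dot_n, h.norm_sq] at hp
  rw [smul_dotProduct, smul_dotProduct, h.dot_k, h.dot_m, smul_eq_mul, smul_eq_mul]
  generalize F (y + s • normal i j) k - F y k = x at *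
  generalize F (y + s • normal i j) l - F y l = x' at *
  generalize F (y + s • normal i j) m - F y m = z at *
  generalize F (y + s • normal i j) n - F y n = z' at *
  have hφ1 := Real.one_lt_goldenRatio
  have hφ2 := Real.goldenRatio_lt_two
  have hsq := Real.goldenRatio_sq
  have hσ : slope * (2 + 2 * Real.goldenRatio ^ 2) = 1 := by
    rw [slope]; field_simp
  generalize slope = σ at *
  generalize Real.goldenRatio = φ at *
  have sq : ∀ y : ℝ, y = 1 ∨ y = -1 → y * y = 1 := by rintro y (rfl | rfl) <;> simp
  have ab : ∀ y z : ℝ, y = 1 ∨ y = -1 → |y * z| = |z| := by rintro y z (rfl | rfl) <;> simp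
  have hC : 0 ≤ C := (abs_nonneg _).trans ht
  have key : c * (z - σ * (s * (2 * φ ^ 2 * c))) =
      -((φ - 1) * (a * (x - σ * (s * (2 * φ * a))))) +
        ((φ - 1) * (a * x - b * x') / 2 + (c * z - d * z') / 2) := by
    have e1 := sq a h.sign_a
    have e3 := sq c h.sign_c
    have hp' : (φ - 1) * (a * x + b * x') + (c * z + d * z') = 2 * s := by
      have h1 : φ ^ 2 * ((φ - 1) * (a * x + b * x') + (c * z + d * z')) = φ ^ 2 * (2 * s) := by
        linear_combination hp / 2 + φ * (a * x + b * x') * hsq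
      exact mul_left_cancel₀ (by positivity) h1
    have e : φ * (φ - 1) = 1 := by linear_combination hsq
    linear_combination hp' / 2 - 2 * σ * s * φ ^ 2 * e3 -
      (φ - 1) * σ * s * 2 * φ * e1 - 2 * σ * s * e - s * hσ
  rw [← ab c _ h.sign_c, ← ab a (x - _) h.sign_a, key]
  refine (abs_add_le _ _).trans ?_
  rw [abs_neg, abs_mul (φ - 1), abs_of_pos (by linarith : 0 < φ - 1)]
  gcongr
  rw [abs_le] at *
  constructor <;> nlinarith

/-- A Lipschitz map which satisfies the worm relations in sufficiently many directions is at
bounded distance from a linear map of slope `slope`. -/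
theorem exists_abs_deviation_le {F : (Fin 3 → ℝ) → (Fin 6 → ℝ)} {Cov : Fin 6 → Fin 6 → Prop}
    {K C : ℝ} (hlip : ∀ x y, ‖F y - F x‖ ≤ K * ‖y - x‖)
    (hproj : ∀ x y, ∑ k, (F y k - F x k) • v k = y - x)
    (hrel : ∀ {i j k l m n a b c d}, PairFrame i j k l m n a b c d → Cov i j →
      ∀ y s, WormRelations F i j k l m n a b c d C y s)
    (hperp : ∀ k y w, w ⬝ᵥ v k = 0 → |F (y + w) k - F y k| ≤ C)
    (hfat : ∀ m, ∃ i j, Cov i j ∧ i ≠ j ∧ m ≠ i ∧ m ≠ j ∧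
      ({i, j, m} : Finset (Fin 6)) ∉ thinTriples) :
    ∃ M, ∀ y w k, |F (y + w) k - F y k - slope * (w ⬝ᵥ v k)| ≤ M := by
  have hC : 0 ≤ C := (abs_nonneg _).trans (hperp 0 0 0 (by simp))
  have hφ1 := Real.one_lt_goldenRatio
  have hφ2 := Real.goldenRatio_lt_two
  have hφsq := Real.goldenRatio_sq
  have hslope : 0 < slope := by rw [slope]; positivity
  -- reduction of a direction to a multiple of a normal vector
  have hred : ∀ m, ∃ i j k l n a b c d, PairFrame i j k l m n a b c d ∧ Cov i j ∧
      ∀ w : Fin 3 → ℝ, ∃ s : ℝ, (s • normal i j) ⬝ᵥ v m = w ⬝ᵥ v m ∧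
        |(s • normal i j) ⬝ᵥ v k| * Real.goldenRatio = |w ⬝ᵥ v m| ∧ |s| ≤ |w ⬝ᵥ v m| ∧
        ∀ y, |F (y + w) m - F y m - slope * (w ⬝ᵥ v m)| ≤
          |F (y + s • normal i j) m - F y m - slope * ((s • normal i j) ⬝ᵥ v m)| + C := by
    intro m
    obtain ⟨i, j, hcov, hij, hmi, hmj, hm⟩ := hfat m
    obtain ⟨k, l, n, a, b, c, d, h⟩ := exists_pairFrame_fat hij hmi hmj hm
    refine ⟨i, j, k, l, n, a, b, c, d, h, hcov, fun w => ?_⟩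
    have ab : ∀ y : ℝ, y = 1 ∨ y = -1 → |y| = 1 := by rintro y (rfl | rfl) <;> simp
    have hc0 : c ≠ 0 := by rcases h.sign_c with rfl | rfl <;> norm_num
    have hpos : (0 : ℝ) < 2 * Real.goldenRatio ^ 2 := by positivity
    have hs : (((w ⬝ᵥ v m) / (2 * Real.goldenRatio ^ 2 * c)) • normal i j) ⬝ᵥ v m = w ⬝ᵥ v m := by
      rw [smul_dotProduct, h.dot_m, smul_eq_mul, div_mul_cancel₀ _ (mul_ne_zero hpos.ne' hc0)]
    have hsabs : |w ⬝ᵥ v m / (2 * Real.goldenRatio ^ 2 * c)| =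
        |w ⬝ᵥ v m| / (2 * Real.goldenRatio ^ 2) := by
      rw [abs_div, abs_mul, ab c h.sign_c, mul_one, abs_of_pos hpos]
    refine ⟨(w ⬝ᵥ v m) / (2 * Real.goldenRatio ^ 2 * c), hs, ?_, ?_, fun y => ?_⟩
    · rw [smul_dotProduct, h.dot_k, smul_eq_mul, abs_mul, hsabs, abs_mul, ab a h.sign_a, mul_one,
        abs_of_pos (by positivity : 0 < 2 * Real.goldenRatio)]
      field_simp
    · rw [hsabs]
      exact div_le_self (abs_nonneg _) (by nlinarith)
    · have hw := hperp m (y + ((w ⬝ᵥ v m) / (2 * Real.goldenRatio ^ 2 * c)) • normal i j)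
        (w - ((w ⬝ᵥ v m) / (2 * Real.goldenRatio ^ 2 * c)) • normal i j)
        (by rw [sub_dotProduct, hs, sub_self])
      rw [add_assoc, add_sub_cancel] at hw
      rw [hs]
      rw [abs_le] at hw
      have h2 := abs_le.1 (le_refl |F (y + (w ⬝ᵥ v m / (2 * Real.goldenRatio ^ 2 * c)) • normal i j) m -
        F y m - slope * (w ⬝ᵥ v m)|)
      rw [abs_le]
      constructor <;> linarith
  obtain ⟨M, hM1, hM2⟩ : ∃ M, |K| * 4 + slope + C ≤ M ∧ 2 * C / (2 - Real.goldenRatio) ≤ M :=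
    ⟨_, le_max_left _ _, le_max_right _ _⟩
  have hM3 : (Real.goldenRatio - 1) * M + 2 * C ≤ M := by
    rw [div_le_iff₀ (by linarith)] at hM2; linarith
  have hscale : ∀ t : ℕ, ∀ y w k, |w ⬝ᵥ v k| ≤ Real.goldenRatio ^ t →
      |F (y + w) k - F y k - slope * (w ⬝ᵥ v k)| ≤ M := by
    intro t
    induction t with
    | zero =>
      intro y w m hw
      rw [pow_zero] at hw
      obtain ⟨i, j, k, l, n, a, b, c, d, h, hcov, hs⟩ := hred m
      obtain ⟨s, hs1, -, hs3, hs4⟩ := hs w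
      refine (hs4 y).trans ?_
      have h1 := (norm_le_pi_norm (F (y + s • normal i j) - F y) m).trans (hlip _ _)
      rw [add_sub_cancel_left, norm_smul, Pi.sub_apply, Real.norm_eq_abs, Real.norm_eq_abs] at h1
      have h2 : |s| * ‖normal i j‖ ≤ 1 * 4 :=
        mul_le_mul (hs3.trans hw) h.norm_normal_le (norm_nonneg _) one_pos.le
      have h3 : K * (|s| * ‖normal i j‖) ≤ |K| * (1 * 4) :=
        (mul_le_mul_of_nonneg_right (le_abs_self K) (by positivity)).trans
          (mul_le_mul_of_nonneg_left h2 (abs_nonneg _))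
      have h4 : |slope * ((s • normal i j) ⬝ᵥ v m)| ≤ slope := by
        rw [hs1, abs_mul, abs_of_pos hslope]
        exact mul_le_of_le_one_right hslope.le hw
      have h5 := abs_sub (F (y + s • normal i j) m - F y m) (slope * ((s • normal i j) ⬝ᵥ v m))
      linarith
    | succ t ih =>
      intro y w m hw
      obtain ⟨i, j, k, l, n, a, b, c, d, h, hcov, hs⟩ := hred m
      obtain ⟨s, hs1, hs2, hs3, hs4⟩ := hs w
      refine (hs4 y).trans ?_
      have h1 := h.abs_deviation_le hproj (hrel h hcov y s)
      have h2 := ih y (s • normal i j) k (by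
        rw [← hs2, pow_succ] at hw
        exact le_of_mul_le_mul_right hw (by linarith))
      have h3 := mul_le_mul_of_nonneg_left h2 (by linarith : 0 ≤ Real.goldenRatio - 1)
      linarith
  refine ⟨M, fun y w k => ?_⟩
  obtain ⟨t, ht⟩ := pow_unbounded_of_one_lt |w ⬝ᵥ v k| hφ1
  exact hscale t y w k ht.le

/-- If `f k` hardly varies along the three normal vectors of a triple, then neither does it vary
along the other vectors. -/
lemma exists_abs_sub_le_of_normals {i j l : Fin 6} (hij : i ≠ j) (hli : l ≠ i) (hlj : l ≠ j)
    {g : (Fin 3 → ℝ) → ℝ} {C : ℝ} {P : (Fin 3 → ℝ) → Prop}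
    (h1 : (∀ w, P w → v i ⬝ᵥ w = 0) ∨ ∀ (y : Fin 3 → ℝ) (s : ℝ), |g (y + s • normal j l) - g y| ≤ C)
    (h2 : (∀ w, P w → v j ⬝ᵥ w = 0) ∨ ∀ (y : Fin 3 → ℝ) (s : ℝ), |g (y + s • normal l i) - g y| ≤ C)
    (h3 : (∀ w, P w → v l ⬝ᵥ w = 0) ∨ ∀ (y : Fin 3 → ℝ) (s : ℝ), |g (y + s • normal i j) - g y| ≤ C)
    (hC : 0 ≤ C) (y w : Fin 3 → ℝ) (hw : P w) : |g (y + w) - g y| ≤ 3 * C := by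
  have h0 := triple_ne_zero hij hli hlj
  have hdec := triple_smul_eq_sum_cross (v i) (v j) (v l) w
  have hstep : ∀ (x : Fin 6) (u : Fin 3 → ℝ),
      ((∀ w, P w → v x ⬝ᵥ w = 0) ∨
        ∀ (y : Fin 3 → ℝ) (s : ℝ), |g (y + s • u) - g y| ≤ C) →
      ∀ y, |g (y + ((normal i j ⬝ᵥ v l)⁻¹ * (v x ⬝ᵥ w)) • u) - g y| ≤ C := by
    rintro x u (h | h) y
    · rw [h w hw]; simpa using hC
    · exact h y _
  have e : w = ((normal i j ⬝ᵥ v l)⁻¹ * (v i ⬝ᵥ w)) • normal j l +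
      ((normal i j ⬝ᵥ v l)⁻¹ * (v j ⬝ᵥ w)) • normal l i +
      ((normal i j ⬝ᵥ v l)⁻¹ * (v l ⬝ᵥ w)) • normal i j := by
    rw [mul_smul, mul_smul, mul_smul, ← smul_add, ← smul_add, eq_inv_smul_iff₀ h0]
    exact hdec
  have s1 := hstep i _ h1 y
  have s2 := hstep j _ h2 (y + ((normal i j ⬝ᵥ v l)⁻¹ * (v i ⬝ᵥ w)) • normal j l)
  have s3 := hstep l _ h3 (y + ((normal i j ⬝ᵥ v l)⁻¹ * (v i ⬝ᵥ w)) • normal j l +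
    ((normal i j ⬝ᵥ v l)⁻¹ * (v j ⬝ᵥ w)) • normal l i)
  nth_rewrite 1 [e]
  rw [← add_assoc, ← add_assoc]
  rw [abs_le] at *
  constructor <;> linarith

end Golden

namespace Golden

open Filter Topology

variable {i j k l m n : Fin 6} {a b c d : ℝ}

set_option maxRecDepth 10000 in
lemma exists_fat_of_four (m p q r : Fin 6) (hpq : p ≠ q) (hpr : p ≠ r) (hqr : q ≠ r) (hp : m ≠ p)
    (hq : m ≠ q) (hr : m ≠ r) : ({p, q, m} : Finset (Fin 6)) ∉ thinTriples ∨
      ({p, r, m} : Finset (Fin 6)) ∉ thinTriples ∨ ({q, r, m} : Finset (Fin 6)) ∉ thinTriples := by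
  revert m p q r
  decide

/-- A set of triples that contains, for each pair covered by one of them, either both thin or both
fat triples which extend this pair. -/
def IsTypeClosed (S : Set (Finset (Fin 6))) : Prop :=
  ∀ D ∈ S, ∀ i ∈ D, ∀ j ∈ D, i ≠ j → ∃ x y, x ≠ y ∧ x ≠ i ∧ x ≠ j ∧ y ≠ i ∧ y ≠ j ∧
    ({i, j, x} : Finset (Fin 6)) ∈ S ∧ ({i, j, y} : Finset (Fin 6)) ∈ S

lemma IsTypeClosed.exists_fat {S : Set (Finset (Fin 6))} (hS : IsTypeClosed S)
    (hcard : ∀ D ∈ S, D.card = 3) (hne : S.Nonempty) (m : Fin 6) :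
    ∃ i j, (∃ D ∈ S, i ∈ D ∧ j ∈ D) ∧ i ≠ j ∧ m ≠ i ∧ m ≠ j ∧
      ({i, j, m} : Finset (Fin 6)) ∉ thinTriples := by
  have key : ∀ D ∈ S, m ∉ D → ∃ i j, (∃ D ∈ S, i ∈ D ∧ j ∈ D) ∧ i ≠ j ∧ m ≠ i ∧ m ≠ j ∧
      ({i, j, m} : Finset (Fin 6)) ∉ thinTriples := by
    intro D hD hm
    obtain ⟨p, q, r, hpq, hpr, hqr, rfl⟩ := Finset.card_eq_three.1 (hcard D hD)
    simp only [Finset.mem_insert, Finset.mem_singleton, not_or] at hm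
    obtain ⟨hp, hq, hr⟩ := hm
    rcases exists_fat_of_four m p q r hpq hpr hqr hp hq hr with h | h | h
    · exact ⟨p, q, ⟨_, hD, by simp, by simp⟩, hpq, hp, hq, h⟩
    · exact ⟨p, r, ⟨_, hD, by simp, by simp⟩, hpr, hp, hr, h⟩
    · exact ⟨q, r, ⟨_, hD, by simp, by simp⟩, hqr, hq, hr, h⟩
  obtain ⟨D, hD⟩ := hne
  by_cases hm : m ∈ D
  · obtain ⟨p, hp, q, hq, hpq⟩ : ∃ p ∈ D.erase m, ∃ q ∈ D.erase m, p ≠ q :=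
      Finset.one_lt_card.1 (by rw [Finset.card_erase_of_mem hm, hcard D hD]; norm_num)
    rw [Finset.mem_erase] at hp hq
    obtain ⟨x, y, hxy, -, -, -, -, hx, hy⟩ := hS D hD p hp.2 q hq.2 hpq
    by_cases hxm : m = x
    · exact key _ hy (by simp [hp.1.symm, hq.1.symm, hxm ▸ hxy])
    · exact key _ hx (by simp [hp.1.symm, hq.1.symm, hxm])
  · exact key D hD hm

/-- The directions of the tiles whose positions are at distance at most `R` of `x`. -/
def Tiling.dirsNear (T : Tiling) (x : Fin 3 → ℝ) (R : ℝ) : Set (Finset (Fin 6)) :=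
  {D | ∃ τ ∈ T.tiles, τ.dirs = D ∧ ‖τ.pos - x‖ ≤ R}

lemma Tile.norm_sub_pos_le {τ : Tile} {y : Fin 3 → ℝ} (hy : y ∈ τ.carrier) :
    ‖y - τ.pos‖ ≤ 6 := by
  rw [← sum_chart_smul τ.card_dirs (y - τ.pos)]
  refine (norm_sum_le _ _).trans ((Finset.sum_le_card_nsmul _ _ 2 fun k _ => ?_).trans ?_)
  · have := (τ.mem_carrier_iff y).1 hy k
    rw [norm_smul, Real.norm_eq_abs, abs_of_nonneg this.1]
    have h2 := norm_v_le k
    nlinarith [norm_nonneg (v k)]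
  · rw [τ.card_dirs]; norm_num

lemma Tiling.dirsNear_nonempty (T : Tiling) (x : Fin 3 → ℝ) {R : ℝ} (hR : 6 ≤ R) :
    (T.dirsNear x R).Nonempty := by
  obtain ⟨τ, hτ, hx⟩ := T.exists_mem x
  refine ⟨τ.dirs, τ, hτ, rfl, ?_⟩
  rw [norm_sub_rev]
  exact (Tile.norm_sub_pos_le hx).trans hR

lemma Tiling.dirsNear_subset (T : Tiling) {x y : Fin 3 → ℝ} {R R' : ℝ} (h : ‖y - x‖ + R ≤ R') :
    T.dirsNear y R ⊆ T.dirsNear x R' := by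
  rintro D ⟨τ, hτ, hD, hR⟩
  refine ⟨τ, hτ, hD, ?_⟩
  have := norm_sub_le_norm_sub_add_norm_sub τ.pos y x
  linarith

/-- Among three successive tiles of a worm, there are two different ones of the same type. -/
lemma Tiling.exists_two_dirsNear {T : Tiling} (hT : T.HasAlternation) (hij : i ≠ j) {τ : Tile}
    (hτ : τ ∈ T.tiles) (hi : i ∈ τ.dirs) (hj : j ∈ τ.dirs) :
    ∃ x y, x ≠ y ∧ x ≠ i ∧ x ≠ j ∧ y ≠ i ∧ y ≠ j ∧
      ({i, j, x} : Finset (Fin 6)) ∈ T.dirsNear τ.pos 8 ∧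
      ({i, j, y} : Finset (Fin 6)) ∈ T.dirsNear τ.pos 8 := by
  obtain ⟨s, κ, hs0, hw⟩ := T.exists_wormData hij hτ hi hj
  have hq : ∀ t, ‖(s (t + 1)).lowerBase i j (κ (t + 1)) - (s t).lowerBase i j (κ t)‖ ≤ 2 := by
    intro t
    rw [hw.lowerBase_succ, Tile.upperBase_eq, add_sub_cancel_left]
    refine norm_smul_sign_le ?_ _
    rw [tripleSign]; split_ifs <;> simp
  have hpos : ∀ t, ‖(s t).lowerBase i j (κ t) - (s t).pos‖ ≤ 2 := fun t =>
    Tile.norm_lowerBase_sub_pos_le _ _ _ _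
  have h0 := hpos 0
  have h1 := hpos 1
  have h2 := hpos 2
  have h01 : ‖(s 1).lowerBase i j (κ 1) - (s 0).lowerBase i j (κ 0)‖ ≤ 2 := hq 0
  have h12 : ‖(s 2).lowerBase i j (κ 2) - (s 1).lowerBase i j (κ 1)‖ ≤ 2 := hq 1
  have d1 : ‖(s 1).pos - τ.pos‖ ≤ 8 := by
    rw [← hs0]
    have e : (s 1).pos - (s 0).pos = ((s 1).lowerBase i j (κ 1) - (s 0).lowerBase i j (κ 0)) +
        ((s 0).lowerBase i j (κ 0) - (s 0).pos) - ((s 1).lowerBase i j (κ 1) - (s 1).pos) := by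
      abel
    rw [e]
    refine (norm_sub_le _ _).trans ?_
    have := norm_add_le ((s 1).lowerBase i j (κ 1) - (s 0).lowerBase i j (κ 0))
      ((s 0).lowerBase i j (κ 0) - (s 0).pos)
    linarith
  have d2 : ‖(s 2).pos - τ.pos‖ ≤ 8 := by
    rw [← hs0]
    have e : (s 2).pos - (s 0).pos = ((s 2).lowerBase i j (κ 2) - (s 1).lowerBase i j (κ 1)) +
        ((s 1).lowerBase i j (κ 1) - (s 0).lowerBase i j (κ 0)) +
        ((s 0).lowerBase i j (κ 0) - (s 0).pos) - ((s 2).lowerBase i j (κ 2) - (s 2).pos) := by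
      abel
    rw [e]
    refine (norm_sub_le _ _).trans ?_
    have := norm_add₃_le (a := (s 2).lowerBase i j (κ 2) - (s 1).lowerBase i j (κ 1))
      (b := (s 1).lowerBase i j (κ 1) - (s 0).lowerBase i j (κ 0))
      (c := (s 0).lowerBase i j (κ 0) - (s 0).pos)
    linarith
  have hnear : ∀ t, ‖(s t).pos - τ.pos‖ ≤ 8 →
      ({i, j, κ t} : Finset (Fin 6)) ∈ T.dirsNear τ.pos 8 := fun t ht =>
    ⟨s t, hw.isWorm.mem t, hw.dirs_eq t, ht⟩
  have n0 := hnear 0 (by rw [hs0]; simp)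
  have n1 := hnear 1 d1
  have n2 := hnear 2 d2
  have hdiff : ∀ p q, (s p).dirs ≠ (s q).dirs → κ p ≠ κ q := fun p q h h' =>
    h (by rw [hw.dirs_eq, hw.dirs_eq, h'])
  by_cases t01 : (s 0).SameType (s 1)
  · exact ⟨κ 0, κ 1, hdiff _ _ (hT i j hij s hw.isWorm 0 1 one_pos t01 fun l _ _ => by omega),
      hw.ne_i 0, hw.ne_j 0, hw.ne_i 1, hw.ne_j 1, n0, n1⟩
  by_cases t12 : (s 1).SameType (s 2)
  · exact ⟨κ 1, κ 2, hdiff _ _ (hT i j hij s hw.isWorm 1 2 one_lt_two t12 fun l _ _ => by omega),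
      hw.ne_i 1, hw.ne_j 1, hw.ne_i 2, hw.ne_j 2, n1, n2⟩
  · have t02 : (s 0).SameType (s 2) := by
      simp only [Tile.SameType] at *; tauto
    refine ⟨κ 0, κ 2, hdiff _ _ (hT i j hij s hw.isWorm 0 2 two_pos t02 fun l h1 h2 => ?_),
      hw.ne_i 0, hw.ne_j 0, hw.ne_i 2, hw.ne_j 2, n0, n2⟩
    obtain rfl : l = 1 := by omega
    simp only [Tile.SameType] at *; tauto

/-- If some pair of directions is missing in arbitrarily large balls, then a minimal set of
directions of tiles in arbitrarily large balls shows up uniformly in such balls. -/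
lemma Tiling.exists_uniform_dirs (T : Tiling) {S₀ : Set (Finset (Fin 6))}
    (hS₀ : ∀ R, ∃ x, T.dirsNear x R ⊆ S₀) :
    ∃ S ⊆ S₀, (∀ R, ∃ x, T.dirsNear x R ⊆ S) ∧
      ∃ r, ∀ x, T.dirsNear x r ⊆ S → S ⊆ T.dirsNear x r := by
  obtain ⟨S, hSS₀, hS⟩ := exists_minimal_le_of_wellFoundedLT
    (fun S : Set (Finset (Fin 6)) => ∀ R, ∃ x, T.dirsNear x R ⊆ S) S₀ hS₀
  have h : ∀ D, ∃ R, D ∈ S → ∀ x, ¬ T.dirsNear x R ⊆ S \ {D} := by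
    intro D
    by_cases hD : D ∈ S
    · by_contra! hcon
      have : S ≤ S \ {D} :=
        hS.2 (fun R => (hcon R).2) (Set.sdiff_subset : S \ {D} ⊆ S)
      exact (this hD).2 rfl
    · exact ⟨0, fun h => absurd h hD⟩
  choose R hR using h
  refine ⟨S, hSS₀, hS.1, ∑ D, |R D|, fun x hx D hD => ?_⟩
  by_contra hcon
  refine hR D hD x fun D' hD' => ?_
  have hD'' : D' ∈ T.dirsNear x (∑ D, |R D|) := T.dirsNear_subset (by
    rw [sub_self, norm_zero, zero_add]
    exact (le_abs_self _).trans
      (Finset.single_le_sum (f := fun D => |R D|) (fun _ _ => abs_nonneg _) (Finset.mem_univ D))) hD'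
  exact ⟨hx hD'', fun h => hcon (h ▸ hD'')⟩

lemma exists_ultralimit {f : (Fin 3 → ℝ) → (Fin 6 → ℝ)} {K : ℝ}
    (hlip : ∀ x y, ‖f y - f x‖ ≤ K * ‖y - x‖) (x : ℕ → Fin 3 → ℝ) :
    ∃ F : (Fin 3 → ℝ) → (Fin 6 → ℝ), ∀ y k,
      Tendsto (fun t => f (x t + y) k - f (x t) k) (hyperfilter ℕ) (𝓝 (F y k)) := by
  have h : ∀ y k, ∃ z, Tendsto (fun t => f (x t + y) k - f (x t) k) (hyperfilter ℕ) (𝓝 z) := by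
    intro y k
    have hb : ∀ t, f (x t + y) k - f (x t) k ∈ Set.Icc (-(K * ‖y‖)) (K * ‖y‖) := by
      intro t
      have := (norm_le_pi_norm (f (x t + y) - f (x t)) k).trans (hlip _ _)
      rw [add_sub_cancel_left, Pi.sub_apply, Real.norm_eq_abs, abs_le] at this
      exact this
    obtain ⟨z, -, hz⟩ := isCompact_Icc.ultrafilter_le_nhds
      ((hyperfilter ℕ).map fun t => f (x t + y) k - f (x t) k)
      (le_principal_iff.2 (Filter.mem_map.2 (univ_mem' hb)))
    exact ⟨z, hz⟩
  choose F hF using h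
  exact ⟨F, hF⟩

/-- Any two directions are those of a tile at bounded distance of any point. -/
theorem Tiling.exists_dense {T : Tiling} (hT : T.HasAlternation) (hij : i ≠ j) :
    ∃ r, ∀ x, ∃ τ ∈ T.tiles, i ∈ τ.dirs ∧ j ∈ τ.dirs ∧ ‖τ.pos - x‖ ≤ r := by
  by_contra! hno
  obtain ⟨S, hSS₀, hSlarge, r, hr⟩ := T.exists_uniform_dirs (S₀ := {D | ¬ (i ∈ D ∧ j ∈ D)})
    (fun R => by
      obtain ⟨x, hx⟩ := hno R
      refine ⟨x, ?_⟩
      rintro _ ⟨τ, hτ, rfl, hR⟩ ⟨h1, h2⟩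
      exact absurd hR (not_le.2 (hx τ hτ h1 h2)))
  obtain ⟨f, hf⟩ := T.exists_isUnfolding
  obtain ⟨K, hK, hlip⟩ := hf.exists_lipschitz
  obtain ⟨C, hC, hworm⟩ := Tiling.exists_wormRelations hT hf
  choose! x hx using fun t : ℕ => hSlarge t
  obtain ⟨F, hF⟩ := exists_ultralimit hlip x
  have hev : ∀ {P : ℕ → Prop} (R : ℝ), (∀ t : ℕ, R ≤ t → P t) →
      ∀ᶠ t in (hyperfilter ℕ : Filter ℕ), P t := fun R h =>
    Nat.hyperfilter_le_atTop ((eventually_ge_atTop ⌈R⌉₊).mono fun t ht =>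
      h t ((Nat.le_ceil R).trans (by exact_mod_cast ht)))
  have hdense : ∀ (y : Fin 3 → ℝ) (t : ℕ), ‖y‖ + r ≤ t → S ⊆ T.dirsNear (x t + y) r :=
    fun y t ht => hr _ ((T.dirsNear_subset (by rwa [add_sub_cancel_left])).trans (hx t))
  have hcard : ∀ D ∈ S, D.card = 3 := by
    intro D hD
    obtain ⟨t, ht⟩ := exists_nat_ge (‖(0 : Fin 3 → ℝ)‖ + r)
    obtain ⟨τ, -, rfl, -⟩ := hdense 0 t ht hD
    exact τ.card_dirs
  have hne : S.Nonempty := (T.dirsNear_nonempty (x 6) (by norm_num)).mono (hx 6)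
  have hclosed : IsTypeClosed S := by
    intro D hD p hp q hq hpq
    obtain ⟨t, ht⟩ := exists_nat_ge (‖(0 : Fin 3 → ℝ)‖ + max r (r + 8))
    obtain ⟨τ, hτ, rfl, hτr⟩ :=
      hdense 0 t ((add_le_add_right (le_max_left _ _) _).trans ht) hD
    rw [add_zero] at hτr
    obtain ⟨y, z, h1, h2, h3, h4, h5, h6, h7⟩ := Tiling.exists_two_dirsNear hT hpq hτ hp hq
    have hsub : T.dirsNear τ.pos 8 ⊆ S := (T.dirsNear_subset (by
      have := le_max_right r (r + 8)
      rw [norm_zero, zero_add] at ht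
      linarith)).trans (hx t)
    exact ⟨y, z, h1, h2, h3, h4, h5, hsub h6, hsub h7⟩
  set C₁ := C * (1 + r) with hC₁
  have hdiff : ∀ y w k, Tendsto (fun t => f (x t + y + w) k - f (x t + y) k) (hyperfilter ℕ)
      (𝓝 (F (y + w) k - F y k)) := by
    intro y w k
    refine ((hF (y + w) k).sub (hF y k)).congr fun t => ?_
    rw [sub_sub_sub_cancel_right, add_assoc]
  have hFlip : ∀ y z, ‖F z - F y‖ ≤ K * ‖z - y‖ := by
    intro y z
    refine (pi_norm_le_iff_of_nonneg (by positivity)).2 fun k => ?_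
    have h1 := hdiff y (z - y) k
    rw [add_sub_cancel] at h1
    refine le_of_tendsto h1.norm (Eventually.of_forall fun t => ?_)
    have := (norm_le_pi_norm (f (x t + y + (z - y)) - f (x t + y)) k).trans (hlip _ _)
    rwa [add_sub_cancel_left] at this
  have hFproj : ∀ y z, ∑ k, (F z k - F y k) • v k = z - y := by
    intro y z
    have h1 : Tendsto (fun t => ∑ k, (f (x t + y + (z - y)) k - f (x t + y) k) • v k)
        (hyperfilter ℕ) (𝓝 (∑ k, (F z k - F y k) • v k)) := by
      refine tendsto_finsetSum _ fun k _ => ?_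
      have h1 := hdiff y (z - y) k
      rw [add_sub_cancel] at h1
      exact h1.smul_const (v k)
    refine tendsto_nhds_unique h1 ?_
    simp only [hf.sum_smul, add_sub_cancel_left]
    exact tendsto_const_nhds
  have hrel : ∀ {i j k l m n a b c d}, PairFrame i j k l m n a b c d →
      (∃ D ∈ S, i ∈ D ∧ j ∈ D) → ∀ y s, WormRelations F i j k l m n a b c d C₁ y s := by
    rintro i j k l m n a b c d h ⟨D, hD, hi, hj⟩ y s
    have hW : ∀ᶠ t in (hyperfilter ℕ : Filter ℕ),
        WormRelations f i j k l m n a b c d C₁ (x t + y) s := by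
      refine hev (‖y‖ + r) fun t ht => ?_
      obtain ⟨τ, hτ, rfl, hτr⟩ := hdense y t ht hD
      exact (hworm h τ hτ hi hj (x t + y) s r (by rwa [norm_sub_rev])).1
    constructor
    · exact le_of_tendsto (hdiff y _ i).abs (hW.mono fun t ht => ht.left)
    · exact le_of_tendsto (hdiff y _ j).abs (hW.mono fun t ht => ht.right)
    · exact le_of_tendsto (((hdiff y _ k).const_mul a).sub ((hdiff y _ l).const_mul b)).abs
        (hW.mono fun t ht => ht.thin)
    · exact le_of_tendsto (((hdiff y _ m).const_mul c).sub ((hdiff y _ n).const_mul d)).abs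
        (hW.mono fun t ht => ht.fat)
  have hinv : ∀ {i j}, i ≠ j → (∃ D ∈ S, i ∈ D ∧ j ∈ D) → ∀ k,
      (k = i ∨ k = j ∨ ({i, j, k} : Finset (Fin 6)) ∉ S) → ∀ (y : Fin 3 → ℝ) (s : ℝ),
      |F (y + s • normal i j) k - F y k| ≤ C₁ := by
    rintro i j hij hcov k hk y s
    obtain ⟨k', l, m, n, a, b, c, d, h⟩ := exists_pairFrame hij
    by_cases hki : k = i
    · rw [hki]; exact (hrel h hcov y s).left
    by_cases hkj : k = j
    · rw [hkj]; exact (hrel h hcov y s).right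
    have hkS := (hk.resolve_left hki).resolve_left hkj
    obtain ⟨D, hD, hi, hj⟩ := hcov
    refine le_of_tendsto (hdiff y _ k).abs
      (hev (max (‖y‖ + r) (‖y‖ + r + C * (1 + |s|))) fun t ht => ?_)
    obtain ⟨τ, hτ, rfl, hτr⟩ := hdense y t ((le_max_left _ _).trans ht) hD
    refine (hworm h τ hτ hi hj (x t + y) s r (by rwa [norm_sub_rev])).2 k hki hkj
      fun σ hσ hσd => ?_
    by_contra hcon
    refine hkS (hx t ⟨σ, hσ, hσd, ?_⟩)
    have e : σ.pos - x t = (σ.pos - τ.pos) + (τ.pos - (x t + y)) + y := by abel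
    rw [e]
    refine (norm_add₃_le).trans ?_
    have := (le_max_right (‖y‖ + r) (‖y‖ + r + C * (1 + |s|))).trans ht
    rw [not_lt] at hcon
    linarith
  have hC₁0 : 0 ≤ C₁ := by
    obtain ⟨D, hD⟩ := hne
    obtain ⟨p, q, u, hpq, hpu, hqu, rfl⟩ := Finset.card_eq_three.1 (hcard D hD)
    exact (abs_nonneg _).trans (hinv hpq ⟨_, hD, by simp, by simp⟩ p (Or.inl rfl) 0 0)
  have hperp : ∀ k y w, w ⬝ᵥ v k = 0 → |F (y + w) k - F y k| ≤ 3 * C₁ := by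
    intro k y w hw
    by_cases hk : ∃ D ∈ S, k ∈ D
    · obtain ⟨D, hD, hkD⟩ := hk
      obtain ⟨p, hp, q, hq, hpq⟩ : ∃ p ∈ D.erase k, ∃ q ∈ D.erase k, p ≠ q :=
        Finset.one_lt_card.1 (by rw [Finset.card_erase_of_mem hkD, hcard D hD]; norm_num)
      rw [Finset.mem_erase] at hp hq
      exact exists_abs_sub_le_of_normals (g := fun z => F z k) (P := fun w => w ⬝ᵥ v k = 0) hpq
        hp.1.symm hq.1.symm
        (Or.inr (hinv hq.1 ⟨D, hD, hq.2, hkD⟩ k (Or.inr (Or.inl rfl))))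
        (Or.inr (hinv hp.1.symm ⟨D, hD, hkD, hp.2⟩ k (Or.inl rfl)))
        (Or.inl fun w h => by rw [dotProduct_comm]; exact h) hC₁0 y w hw
    · have hk' : ∀ p q, ({p, q, k} : Finset (Fin 6)) ∉ S := fun p q h => hk ⟨_, h, by simp⟩
      obtain ⟨D, hD⟩ := hne
      obtain ⟨p, q, u, hpq, hpu, hqu, rfl⟩ := Finset.card_eq_three.1 (hcard D hD)
      exact exists_abs_sub_le_of_normals (g := fun z => F z k) (P := fun w => w ⬝ᵥ v k = 0) hpq
        hpu.symm hqu.symm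
        (Or.inr (hinv hqu ⟨_, hD, by simp, by simp⟩ k (Or.inr (Or.inr (hk' _ _)))))
        (Or.inr (hinv hpu.symm ⟨_, hD, by simp, by simp⟩ k (Or.inr (Or.inr (hk' _ _)))))
        (Or.inr (hinv hpq ⟨_, hD, by simp, by simp⟩ k (Or.inr (Or.inr (hk' _ _))))) hC₁0 y w hw
  obtain ⟨M, hM⟩ := exists_abs_deviation_le (C := 3 * C₁) hFlip hFproj
    (fun h hcov y s => by
      have := hrel h hcov y s
      exact ⟨this.left.trans (by linarith), this.right.trans (by linarith),
        this.thin.trans (by linarith), this.fat.trans (by linarith)⟩)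
    hperp (hclosed.exists_fat hcard hne)
  have hall : ∀ p q, p ≠ q → (∃ D ∈ S, p ∈ D ∧ q ∈ D) → ∀ k, k ≠ p → k ≠ q →
      ({p, q, k} : Finset (Fin 6)) ∈ S := by
    intro p q hpq hcov k hkp hkq
    by_contra hk
    have hslope : 0 < slope := by rw [slope]; positivity
    have h0 : slope * (normal p q ⬝ᵥ v k) ≠ 0 :=
      mul_ne_zero hslope.ne' (triple_ne_zero hpq hkp hkq)
    have h1 := hinv hpq hcov k (Or.inr (Or.inr hk)) 0
      ((|M| + C₁ + 1) / (slope * (normal p q ⬝ᵥ v k)))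
    have h2 := hM 0 (((|M| + C₁ + 1) / (slope * (normal p q ⬝ᵥ v k))) • normal p q) k
    rw [smul_dotProduct, smul_eq_mul, mul_left_comm, div_mul_cancel₀ _ h0] at h2
    have h3 := le_abs_self M
    rw [abs_le] at h1 h2
    linarith
  obtain ⟨D, hD, hiD⟩ : ∃ D ∈ S, i ∈ D := by
    obtain ⟨D, hD⟩ := hne
    obtain ⟨p, q, u, hpq, hpu, hqu, rfl⟩ := Finset.card_eq_three.1 (hcard D hD)
    by_cases hip : i = p
    · exact ⟨_, hD, by simp [hip]⟩
    by_cases hiq : i = q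
    · exact ⟨_, hD, by simp [hiq]⟩
    exact ⟨_, hall p q hpq ⟨_, hD, by simp, by simp⟩ i hip hiq, by simp⟩
  obtain ⟨u, hu⟩ : (D.erase i).Nonempty :=
    Finset.card_pos.1 (by rw [Finset.card_erase_of_mem hiD, hcard D hD]; norm_num)
  rw [Finset.mem_erase] at hu
  by_cases hju : j = u
  · exact hSS₀ hD ⟨hiD, hju ▸ hu.2⟩
  · exact hSS₀ (hall i u hu.1.symm ⟨D, hD, hiD, hu.2⟩ j hij.symm hju) ⟨by simp, by simp⟩

end Golden

namespace Golden

/-- The components of an unfolding of a tiling with alternation are nearly linear. -/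
theorem Tiling.IsUnfolding.exists_abs_deviation_le {T : Tiling} (hT : T.HasAlternation)
    {f : (Fin 3 → ℝ) → (Fin 6 → ℝ)} (hf : T.IsUnfolding f) :
    ∃ M, ∀ y w k, |f (y + w) k - f y k - slope * (w ⬝ᵥ v k)| ≤ M := by
  obtain ⟨K, hK, hlip⟩ := hf.exists_lipschitz
  obtain ⟨C, hC, hworm⟩ := Tiling.exists_wormRelations hT hf
  have hdense : ∀ p : Fin 6 × Fin 6, ∃ r, p.1 ≠ p.2 → ∀ x, ∃ τ ∈ T.tiles,
      p.1 ∈ τ.dirs ∧ p.2 ∈ τ.dirs ∧ ‖τ.pos - x‖ ≤ r := by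
    intro p
    by_cases hp : p.1 = p.2
    · exact ⟨0, fun h => absurd hp h⟩
    · obtain ⟨r, hr⟩ := Tiling.exists_dense hT hp
      exact ⟨r, fun _ => hr⟩
  choose r hr using hdense
  set R := ∑ p, |r p| with hR
  have hR0 : 0 ≤ R := Finset.sum_nonneg fun _ _ => abs_nonneg _
  have hrR : ∀ p, r p ≤ R := fun p => (le_abs_self _).trans
    (Finset.single_le_sum (f := fun p => |r p|) (fun _ _ => abs_nonneg _) (Finset.mem_univ p))
  have hrel : ∀ {i j k l m n a b c d}, PairFrame i j k l m n a b c d →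
      ∀ y s, WormRelations f i j k l m n a b c d (C * (1 + R)) y s := by
    intro i j k l m n a b c d h y s
    obtain ⟨τ, hτ, hi, hj, hd⟩ := hr (i, j) h.ne.1 y
    exact (hworm h τ hτ hi hj y s R (by rw [norm_sub_rev]; exact hd.trans (hrR _))).1
  have hC₁ : 0 ≤ C * (1 + R) := by positivity
  refine Golden.exists_abs_deviation_le (Cov := fun _ _ => True) (C := 3 * (C * (1 + R))) hlip
    hf.sum_smul (fun h _ y s => ?_) (fun k y w hw => ?_) (fun m => ?_)
  · have := hrel h y s
    exact ⟨this.left.trans (by linarith), this.right.trans (by linarith),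
      this.thin.trans (by linarith), this.fat.trans (by linarith)⟩
  · obtain ⟨p, q, hpq, hkp, hkq⟩ : ∃ p q : Fin 6, p ≠ q ∧ k ≠ p ∧ k ≠ q := by
      clear hw; revert k; decide
    refine exists_abs_sub_le_of_normals (g := fun z => f z k) (P := fun w => w ⬝ᵥ v k = 0) hpq hkp
      hkq (Or.inr fun y s => ?_) (Or.inr fun y s => ?_)
      (Or.inl fun w h => by rw [dotProduct_comm]; exact h) hC₁ y w hw
    · obtain ⟨_, _, _, _, _, _, _, _, h⟩ := exists_pairFrame hkq.symm
      exact (hrel h y s).right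
    · obtain ⟨_, _, _, _, _, _, _, _, h⟩ := exists_pairFrame hkp
      exact (hrel h y s).left
  · obtain ⟨p, q, u, hpq, hpu, hqu, hp, hq, hu⟩ : ∃ p q u : Fin 6, p ≠ q ∧ p ≠ u ∧ q ≠ u ∧
        m ≠ p ∧ m ≠ q ∧ m ≠ u := by
      clear * -; revert m; decide
    rcases exists_fat_of_four m p q u hpq hpu hqu hp hq hu with h | h | h
    · exact ⟨p, q, trivial, hpq, hp, hq, h⟩
    · exact ⟨p, u, trivial, hpu, hp, hu, h⟩
    · exact ⟨q, u, trivial, hqu, hq, hu, h⟩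

/-- The linear map whose range is the slope of the golden tilings with alternation. -/
noncomputable def slopeMap : (Fin 3 → ℝ) →ₗ[ℝ] (Fin 6 → ℝ) where
  toFun x k := x ⬝ᵥ v k
  map_add' x y := by ext k; simp [add_dotProduct]
  map_smul' r x := by ext k; simp [smul_dotProduct]

lemma slopeMap_injective : Function.Injective slopeMap := by
  refine (injective_iff_map_eq_zero _).2 fun x hx => ?_
  have h : ∀ k, v k ⬝ᵥ x = 0 := fun k => by
    rw [dotProduct_comm]; exact congrFun hx k
  have h0 : normal 0 1 ⬝ᵥ v 2 ≠ 0 := triple_ne_zero (by decide) (by decide) (by decide)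
  have h1 := triple_smul_eq_sum_cross (v 0) (v 1) (v 2) x
  rw [h, h, h, zero_smul, zero_smul, zero_smul, add_zero, add_zero] at h1
  exact (smul_eq_zero.1 h1).resolve_left h0

lemma one_dotProduct_v_bounds (k : Fin 6) :
    Real.goldenRatio - 1 ≤ (1 : Fin 3 → ℝ) ⬝ᵥ v k ∧ (1 : Fin 3 → ℝ) ⬝ᵥ v k ≤ 3 := by
  have h2 := Real.goldenRatio_lt_two
  have hv : (1 : Fin 3 → ℝ) ⬝ᵥ v k = v k 0 + v k 1 + v k 2 := by
    simp [dotProduct, Fin.sum_univ_three]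
  rw [hv]
  fin_cases k <;> simp only [v] <;> simp <;> (try constructor) <;> linarith

end Golden

theorem mainTheorem1 (T : Golden.Tiling) (hT : T.HasAlternation) : T.IsPlanar := by
  obtain ⟨f, hf⟩ := T.exists_isUnfolding
  obtain ⟨M, hM⟩ := hf.exists_abs_deviation_le hT
  obtain ⟨τ₀, hτ₀, -⟩ := T.exists_mem 0
  set x₀ := τ₀.pos with hx₀
  have hx₀v : x₀ ∈ T.vertices := ⟨τ₀, hτ₀, ∅, by simp, by simp [Golden.Tile.corner, hx₀]⟩
  have hβ : 0 < Real.goldenRatio - 1 := by linarith [Real.one_lt_goldenRatio]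
  set r : ℝ := (|M| + 2) / (Real.goldenRatio - 1) with hr
  have hr0 : 0 < r := by positivity
  refine ⟨|M| + 2 + 3 * r, by linarith [abs_nonneg M], LinearMap.range Golden.slopeMap, ?_, _,
    hf.isLift_floor hx₀v, ?_⟩
  · rw [LinearMap.finrank_range_of_inj Golden.slopeMap_injective]; simp
  rintro p hp
  obtain ⟨τ, hτ, c, hc, rfl⟩ : ∃ τ ∈ T.tiles, p ∈ Golden.cell Golden.e
      (fun k => ((⌊f τ.pos k⌋ - ⌊f x₀ k⌋ : ℤ) : ℝ)) τ.dirs := by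
    simpa [Golden.Tiling.lifted] using hp
  set w := Golden.slope • (τ.pos - x₀) - r • (1 : Fin 3 → ℝ) with hw
  refine Set.mem_add.2 ⟨Golden.slopeMap w, ⟨w, rfl⟩, _, ?_, add_sub_cancel _ _⟩
  have key : ∀ k, -(|M| + 2) + r * ((1 : Fin 3 → ℝ) ⬝ᵥ Golden.v k) ≤
      ((fun k => ((⌊f τ.pos k⌋ - ⌊f x₀ k⌋ : ℤ) : ℝ)) + ∑ i ∈ τ.dirs, c i • Golden.e i -
        Golden.slopeMap w) k ∧
      ((fun k => ((⌊f τ.pos k⌋ - ⌊f x₀ k⌋ : ℤ) : ℝ)) + ∑ i ∈ τ.dirs, c i • Golden.e i -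
        Golden.slopeMap w) k ≤ |M| + 2 + r * ((1 : Fin 3 → ℝ) ⬝ᵥ Golden.v k) := by
    intro k
    have h1 := hM x₀ (τ.pos - x₀) k
    rw [add_sub_cancel] at h1
    have h2 := Int.floor_le (f τ.pos k)
    have h3 := Int.lt_floor_add_one (f τ.pos k)
    have h4 := Int.floor_le (f x₀ k)
    have h5 := Int.lt_floor_add_one (f x₀ k)
    have h6 : 0 ≤ (∑ i ∈ τ.dirs, c i • Golden.e i) k ∧
        (∑ i ∈ τ.dirs, c i • Golden.e i) k ≤ 1 := by
      have e : (∑ i ∈ τ.dirs, c i • Golden.e i) k = if k ∈ τ.dirs then c k else 0 := by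
        simp [Golden.e, Finset.sum_apply, Pi.single_apply]
      rw [e]
      split_ifs
      · exact hc k
      · norm_num
    have h7 : Golden.slopeMap w k = Golden.slope * ((τ.pos - x₀) ⬝ᵥ Golden.v k) -
        r * ((1 : Fin 3 → ℝ) ⬝ᵥ Golden.v k) := by
      show w ⬝ᵥ Golden.v k = _
      rw [hw, sub_dotProduct, smul_dotProduct, smul_dotProduct, smul_eq_mul, smul_eq_mul]
    have h8 := le_abs_self M
    rw [Pi.sub_apply, Pi.add_apply, h7]
    push_cast
    rw [abs_le] at h1
    constructor <;> linarith
  have hr1 : r * (Real.goldenRatio - 1) = |M| + 2 := by rw [hr]; exact div_mul_cancel₀ _ hβ.ne'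
  constructor <;> intro k
  · have h1 := mul_le_mul_of_nonneg_left (Golden.one_dotProduct_v_bounds k).1 hr0.le
    refine le_trans ?_ (key k).1
    simp only [Pi.zero_apply]
    linarith
  · have h1 := mul_le_mul_of_nonneg_left (Golden.one_dotProduct_v_bounds k).2 hr0.le
    refine (key k).2.trans ?_
    linarith
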